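/- Let $\Sigma$ be a finite alphabet with $|\Sigma|\ge 2$ and let $\Xi$ be a countably infinite set of variables, disjoint from $\Sigma$. Regex: $\emptyset$ is a regex that occurs in no other regex. All other regex are built from $\varepsilon$, letters $a\in\Sigma$ and variable references $\&x$ ($x\in\Xi$) by concatenation, disjunction $(\alpha\mid\beta)$, Kleene plus $\alpha^+$, and variable bindings $\langle x:\alpha\rangle$, where $x$ must not occur in $\alpha$ (neither as a reference nor as a binding). $\mathrm{var}(\alpha)$ is the set of variables that occur in $\alpha$, as references or in bindings. Semantics: let $\Gamma=\{[_x,\,]_x \mid x\in\Xi\}$. Let $\alpha_{\mathcal R}$ be the ordinary regular expression over $\Sigma\cup\Xi\cup\Gamma$ that is obtained from $\alpha$ by replacing every binding $\langle x:\beta\rangle$ by $[_x\,\beta\,]_x$ and every $\&x$ by $x$. The words of its language $\mathcal R(\alpha)$ are the ref-words of $\alpha$. The dereference $\mathcal D(r)\in\Sigma^*$ of a ref-word $r$ arises by replacing each occurrence of a variable $x$ by the (recursively dereferenced) content $v$ of the last factor $[_x\,v\,]_x$ to its left, or by $\varepsilon$ if there is none, and deleting all symbols of $\Gamma$. The language of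 $\alpha$ is $\mathcal L(\alpha)=\{\mathcal D(r)\mid r\in\mathcal R(\alpha)\}$. Determinism: mark the occurrences of symbols of $\Sigma\cup\Xi\cup\Gamma$ in $\alpha_{\mathcal R}$ by pairwise distinct numbers, giving a marked expression, and let $R$ be its language of marked words. The regex $\alpha$ is not deterministic if there are $\rho_1,\rho_2\in R$, marked words $r,s_1,s_2$ and words $\gamma_1,\gamma_2$ over marked symbols of $\Gamma$ such that one of the following holds: (1) $\rho_1=r\gamma_1a_{(i)}s_1$ and $\rho_2=r\gamma_2a_{(j)}s_2$ with $a\in\Sigma$, $i\ne j$; (2) $\rho_1=r\gamma_1x_{(i)}s_1$ and $\rho_2=r\gamma_2\chi_{(j)}s_2$ with $x\in\Xi$, $\chi\in\Sigma\cup\Xi$, $i\neq j$; (3) $\rho_1=r\gamma_1\chi_{(i)}s_1$ and $\rho_2=r\gamma_2\chi_{(i)}s_2$ with $\chi\in\Sigma\cup\Xi$, $\gamma_1\ne\gamma_2$; (4) $\rho_1=r\gamma_1$ and $\rho_2=r\gamma_2$ with $\gamma_1\ne\gamma_2$. Otherwise $\alpha$ is deterministic. Theorem. Given two deterministic regex $\alpha$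 and $\beta$ over $\Sigma$, it is undecidable whether $\mathcal L(\alpha)\cap\mathcal L(\beta)=\emptyset$: there is no algorithm that, for all deterministic regex $\alpha,\beta$ over $\Sigma$, halts on the input $(\alpha,\beta)$ and answers this question correctly (its behaviour on other inputs is arbitrary). This holds for every such $\Sigma$, in particular for $|\Sigma|=2$, and it remains true if the inputs are restricted to deterministic regex $\alpha$ and $\beta$ with $|\mathrm{var}(\alpha)|=2$ and $|\mathrm{var}(\beta)|=3$. -/

import Mathlib

namespace DetRegex

/-! ### Syntax of regex with backreferences -/

/-- Raw expressions over the terminal alphabet `Fin k` and the variable alphabet `ℕ`.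
`ref x` is the variable reference `&x`, and `bind x α` is the variable binding `⟨x : α⟩`.
The side conditions on `∅` and on bindings are in `IsRegex`. -/
inductive Regex (k : ℕ) : Type
  | empty : Regex k
  | eps : Regex k
  | term (a : Fin k) : Regex k
  | ref (x : ℕ) : Regex k
  | cat (α β : Regex k) : Regex k
  | alt (α β : Regex k) : Regex k
  | plus (α : Regex k) : Regex k
  | bind (x : ℕ) (α : Regex k) : Regex k

namespace Regex

variable {k : ℕ}

/-- The set `var(α)` of variables of `α`. -/
def vars : Regex k → Finset ℕ
  | empty => ∅
  | eps => ∅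
  | term _ => ∅
  | ref x => {x}
  | cat α β => α.vars ∪ β.vars
  | alt α β => α.vars ∪ β.vars
  | plus α => α.vars
  | bind x α => insert x α.vars

/-- `∅` does not occur, and in every binding of `x` to `α` the variable `x` is not in `var(α)`. -/
def WellFormed : Regex k → Prop
  | empty => False
  | eps => True
  | term _ => True
  | ref _ => True
  | cat α β => α.WellFormed ∧ β.WellFormed
  | alt α β => α.WellFormed ∧ β.WellFormed
  | plus α => α.WellFormed
  | bind x α => α.WellFormed ∧ x ∉ α.vars

/-- The set `RX` of regex: `∅` is a regex, but it does not occur in any other regex. -/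
def IsRegex (α : Regex k) : Prop := α = empty ∨ α.WellFormed

/-! ### Gödel numbering of expressions, as inputs of algorithms -/

/-- The Gödel number of an expression. -/
def code : Regex k → ℕ
  | empty => 0
  | eps => 1
  | term a => a + 2
  | ref x => 5 * x + (k + 2)
  | cat α β => 5 * Nat.pair α.code β.code + 1 + (k + 2)
  | alt α β => 5 * Nat.pair α.code β.code + 2 + (k + 2)
  | plus α => 5 * α.code + 3 + (k + 2)
  | bind x α => 5 * Nat.pair x α.code + 4 + (k + 2)

/-- The expression with a given Gödel number. -/
def ofCode (k : ℕ) (n : ℕ) : Regex k :=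
  if n = 0 then empty
  else if n = 1 then eps
  else if h : n - 2 < k then term ⟨n - 2, h⟩
  else if n < k + 2 then eps
  else
    let m := (n - (k + 2)) / 5
    if (n - (k + 2)) % 5 = 0 then ref m
    else if (n - (k + 2)) % 5 = 1 then cat (ofCode k m.unpair.1) (ofCode k m.unpair.2)
    else if (n - (k + 2)) % 5 = 2 then alt (ofCode k m.unpair.1) (ofCode k m.unpair.2)
    else if (n - (k + 2)) % 5 = 3 then plus (ofCode k m)
    else bind m.unpair.1 (ofCode k m.unpair.2)
termination_by n
decreasing_by
  all_goals
    have h1 := Nat.unpair_left_le ((n - (k + 2)) / 5)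
    have h2 := Nat.unpair_right_le ((n - (k + 2)) / 5)
    omega

theorem ofCode_code (α : Regex k) : ofCode k α.code = α := by
  induction α with
  | empty => rw [ofCode]; simp [code]
  | eps => rw [ofCode]; simp [code]
  | term a => rw [ofCode]; simp [code]
  | ref x =>
    rw [ofCode, code]
    rw [if_neg (by omega), if_neg (by omega), dif_neg (by omega), if_neg (by omega)]
    simp
  | cat α β iα iβ =>
    rw [ofCode, code]
    rw [if_neg (by omega), if_neg (by omega), dif_neg (by omega), if_neg (by omega)]
    have h1 : (5 * Nat.pair α.code β.code + 1) / 5 = Nat.pair α.code β.code := by omega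
    have h2 : (5 * Nat.pair α.code β.code + 1) % 5 = 1 := by omega
    simp [h1, h2, iα, iβ]
  | alt α β iα iβ =>
    rw [ofCode, code]
    rw [if_neg (by omega), if_neg (by omega), dif_neg (by omega), if_neg (by omega)]
    have h1 : (5 * Nat.pair α.code β.code + 2) / 5 = Nat.pair α.code β.code := by omega
    have h2 : (5 * Nat.pair α.code β.code + 2) % 5 = 2 := by omega
    simp [h1, h2, iα, iβ]
  | plus α iα =>
    rw [ofCode, code]
    rw [if_neg (by omega), if_neg (by omega), dif_neg (by omega), if_neg (by omega)]
    have h1 : (5 * α.code + 3) / 5 = α.code := by omega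
    have h2 : (5 * α.code + 3) % 5 = 3 := by omega
    simp [h1, h2, iα]
  | bind x α iα =>
    rw [ofCode, code]
    rw [if_neg (by omega), if_neg (by omega), dif_neg (by omega), if_neg (by omega)]
    have h1 : (5 * Nat.pair x α.code + 4) / 5 = Nat.pair x α.code := by omega
    have h2 : (5 * Nat.pair x α.code + 4) % 5 = 4 := by omega
    simp [h1, h2, iα]

theorem code_ofCode (n : ℕ) : (ofCode k n).code = n := by
  induction n using Nat.strong_induction_on with
  | _ n ih =>
    rw [ofCode]
    have h1 := Nat.unpair_left_le ((n - (k + 2)) / 5)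
    have h2 := Nat.unpair_right_le ((n - (k + 2)) / 5)
    split_ifs with c0 c1 c2 c3 c4 c5 c6 c7
    · simp [code, c0]
    · simp [code, c1]
    · simp only [code]; omega
    · omega
    · simp only [code]; omega
    · simp only [code]
      rw [ih _ (by omega), ih _ (by omega), Nat.pair_unpair]; omega
    · simp only [code]
      rw [ih _ (by omega), ih _ (by omega), Nat.pair_unpair]; omega
    · simp only [code]
      rw [ih _ (by omega)]; omega
    · simp only [code]
      rw [ih _ (by omega), Nat.pair_unpair]; omega

/-- The Gödel numbering is a bijection with `ℕ`; it is what makes `Regex k` an input type of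
partial recursive functions (`Partrec`). -/
instance instDenumerable : Denumerable (Regex k) :=
  Denumerable.mk' ⟨code, ofCode k, ofCode_code, code_ofCode⟩

end Regex

/-! ### Proper regular expressions and marking -/

/-- Proper regular expressions over an arbitrary alphabet, with Kleene plus. -/
inductive PRegex (B : Type) : Type
  | empty : PRegex B
  | eps : PRegex B
  | sym (b : B) : PRegex B
  | cat (α β : PRegex B) : PRegex B
  | alt (α β : PRegex B) : PRegex B
  | plus (α : PRegex B) : PRegex B

namespace PRegex

variable {B : Type}

/-- The language of a proper regular expression. -/
def lang : PRegex B → Language B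
  | empty => 0
  | eps => 1
  | sym b => {[b]}
  | cat α β => α.lang * β.lang
  | alt α β => α.lang + β.lang
  | plus α => α.lang * KStar.kstar α.lang

/-- The number of occurrences of symbols. -/
def occ : PRegex B → ℕ
  | empty => 0
  | eps => 0
  | sym _ => 1
  | cat α β => α.occ + β.occ
  | alt α β => α.occ + β.occ
  | plus α => α.occ

/-- Number the occurrences of symbols from left to right, starting with `n`. -/
def markFrom : PRegex B → ℕ → PRegex (B × ℕ)
  | empty, _ => empty
  | eps, _ => eps
  | sym b, n => sym (b, n)
  | cat α β, n => cat (α.markFrom n) (β.markFrom (n + α.occ))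
  | alt α β, n => alt (α.markFrom n) (β.markFrom (n + α.occ))
  | plus α, n => plus (α.markFrom n)

end PRegex

/-! ### Ref-words and the language of a regex -/

/-- The alphabet of ref-words: terminals, variables, and for every variable `x` an opening
bracket `op x` and a closing bracket `cl x`. -/
inductive RefSym (k : ℕ) : Type
  | term (a : Fin k) : RefSym k
  | var (x : ℕ) : RefSym k
  | op (x : ℕ) : RefSym k
  | cl (x : ℕ) : RefSym k
  deriving DecidableEq

namespace RefSym

variable {k : ℕ}

/-- The symbol is one of the brackets `op x`, `cl x`. -/
def IsBracket : RefSym k → Prop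
  | term _ => False
  | var _ => False
  | op _ => True
  | cl _ => True

/-- The terminal letter, if the symbol is one. -/
def letter : RefSym k → Option (Fin k)
  | term a => some a
  | var _ => none
  | op _ => none
  | cl _ => none

end RefSym

/-- The terminals in the content `v` of the last factor `op x · v · cl x` of a ref-word
(the empty word if there is none). The argument `q` is the ref-word in reversed order. -/
def lastValue {k : ℕ} (x : ℕ) (q : List (RefSym k)) : List (Fin k) :=
  (((q.dropWhile (fun s => s ≠ RefSym.cl x)).tail.takeWhile
    (fun s => s ≠ RefSym.op x)).reverse).filterMap RefSym.letter

/-- Replace, from left to right, every variable `x` in a ref-word by the content of the last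
binding of `x` to its left. In `resolve q r`, the word `q` is the part that has already been
processed (in reversed order, free of variables) and `r` is the remaining part. The brackets of
other variables inside a copied content are left out of the copy, because every variable points
to a binding of the original ref-word. -/
def resolve {k : ℕ} : List (RefSym k) → List (RefSym k) → List (RefSym k)
  | q, [] => q.reverse
  | q, RefSym.var x :: r => resolve (((lastValue x q).map RefSym.term).reverse ++ q) r
  | q, RefSym.term a :: r => resolve (RefSym.term a :: q) r
  | q, RefSym.op x :: r => resolve (RefSym.op x :: q) r
  | q, RefSym.cl x :: r => resolve (RefSym.cl x :: q) r

/-- The dereference of a ref-word: replace all variables, then remove all brackets. -/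
def deref {k : ℕ} (r : List (RefSym k)) : List (Fin k) :=
  (resolve [] r).filterMap RefSym.letter

namespace Regex

variable {k : ℕ}

/-- The proper regular expression over terminals, variables and brackets that generates the
ref-words of `α`: a binding of `x` to `β` becomes `op x · β · cl x`. -/
def toRef : Regex k → PRegex (RefSym k)
  | empty => PRegex.empty
  | eps => PRegex.eps
  | term a => PRegex.sym (RefSym.term a)
  | ref x => PRegex.sym (RefSym.var x)
  | cat α β => PRegex.cat α.toRef β.toRef
  | alt α β => PRegex.alt α.toRef β.toRef
  | plus α => PRegex.plus α.toRef
  | bind x α =>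
      PRegex.cat (PRegex.sym (RefSym.op x)) (PRegex.cat α.toRef (PRegex.sym (RefSym.cl x)))

/-- The ref-language of a regex. -/
def refLang (α : Regex k) : Language (RefSym k) := α.toRef.lang

/-- The language of a regex: the dereferences of its ref-words. -/
def lang (α : Regex k) : Set (List (Fin k)) := deref '' α.refLang

/-- The marked ref-language of a regex: each occurrence of a terminal, variable or bracket in the
expression carries its own number `1, 2, …`. -/
def markedRefLang (α : Regex k) : Language (RefSym k × ℕ) := (α.toRef.markFrom 1).lang

/-- The regex is not deterministic: two marked ref-words of the form `r · γ₁ ⋯` and `r · γ₂ ⋯`,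
where `γ₁` and `γ₂` are words over the marked brackets, show that the next step of a matcher is
not determined. The four cases are: two occurrences of the same terminal; an occurrence of a
variable against a different occurrence of some terminal or variable; the same occurrence of a
terminal or variable, reached by different words `γ₁ ≠ γ₂`; the end of the word, reached by
different words `γ₁ ≠ γ₂`. -/
def IsNondeterministic (α : Regex k) : Prop :=
  ∃ ρ₁ ∈ α.markedRefLang, ∃ ρ₂ ∈ α.markedRefLang,
    ∃ r s₁ s₂ γ₁ γ₂ : List (RefSym k × ℕ),
      (∀ m ∈ γ₁, m.1.IsBracket) ∧ (∀ m ∈ γ₂, m.1.IsBracket) ∧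
      ((∃ (a : Fin k) (i j : ℕ), i ≠ j ∧
          ρ₁ = r ++ γ₁ ++ [(RefSym.term a, i)] ++ s₁ ∧
          ρ₂ = r ++ γ₂ ++ [(RefSym.term a, j)] ++ s₂) ∨
        (∃ (x : ℕ) (χ : RefSym k) (i j : ℕ), ¬ χ.IsBracket ∧ i ≠ j ∧
          ρ₁ = r ++ γ₁ ++ [(RefSym.var x, i)] ++ s₁ ∧
          ρ₂ = r ++ γ₂ ++ [(χ, j)] ++ s₂) ∨
        (∃ (χ : RefSym k) (i : ℕ), ¬ χ.IsBracket ∧ γ₁ ≠ γ₂ ∧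
          ρ₁ = r ++ γ₁ ++ [(χ, i)] ++ s₁ ∧
          ρ₂ = r ++ γ₂ ++ [(χ, i)] ++ s₂) ∨
        (γ₁ ≠ γ₂ ∧ ρ₁ = r ++ γ₁ ∧ ρ₂ = r ++ γ₂))

/-- The set `DRX` of deterministic regex. -/
def IsDeterministicRegex (α : Regex k) : Prop := α.IsRegex ∧ ¬ α.IsNondeterministic

end Regex

/-! ### Algorithms for problems with a promise on the input -/

/-- There is an algorithm that halts on every input `x` satisfying the promise `P` and then
answers correctly whether `Q x` holds; nothing is required of it on other inputs. -/
def DecidableGiven {X : Type} [Primcodable X] (P Q : X → Prop) : Prop :=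
  ∃ f : X →. Bool, Partrec f ∧ ∀ x, P x → ∃ b ∈ f x, (b = true ↔ Q x)

end DetRegex

/-! ### A machine that works on a list and a stack of lists -/

namespace DetRegex

/-! The halting problem is reduced to the existence of a common word. A halting run c₀, c₁, …, cₙ of
a machine is recorded by the word c₀c₀c₁c₁…cₙcₙ11, which can be cut in two ways. As
(c₀c₀)(c₁c₁)…(cₙcₙ)11 it is a word of `pairsRegex`, which only compares the two halves of each
block. As c₀(c₀c₁)(c₁c₂)…(cₙ1)1 it is a word of `traceRegex`, which fixes the initial configuration
and requires each block to be a configuration followed by its result, where halting yields the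
letter 1. Configurations form a prefix code, so both ways of cutting are forced, and the equalities
chain the blocks into a run: `dom_of_trace`, `exists_trace_of_dom`.

One machine step has to be checked by a regex that reads a configuration from left to right and
rebuilds it from stored pieces. Hence the store is a list and a stack of lists, instructions look
only at their front, and three variables suffice for the untouched pieces (`branch`,
`after_branch`). Compiling `Turing.ToPartrec.Code` shows that such machines are universal; the
program is fixed and only its input varies (`exists_undecidable_program`).

Determinism is deduced from a stronger property, `PrefixFree`: any two different marked ref-words
part, up to brackets, at two different terminals. It is preserved by concatenation and binding
without further conditions, and by disjunctions and loops whose alternatives begin with different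
terminals. In the codes used here every choice is announced by a letter 0 or 1, so two letters are
enough.

The languages are computed with a relational semantics: bindings contain no variables, so a
processed prefix acts on the future only through the current values of the variables
(`matches_iff`). -/

/-- Instructions of a machine whose store is a list of numbers and a stack of such lists. The
arguments are the addresses of the possible successor instructions. -/
inductive Instr : Type
  | zero (q : ℕ)
  | succ (q : ℕ)
  | tail (q : ℕ)
  | dup (q : ℕ)
  | swap (q : ℕ)
  | cons (q : ℕ)
  | case (q r : ℕ)
  | halt

namespace Instr

/-- A configuration: the address of the next instruction, the list and the stack. -/
abbrev Config : Type := ℕ × List ℕ × List (List ℕ)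

/-- The effect of an instruction on the list and the stack. -/
def exec : Instr → List ℕ → List (List ℕ) → Option Config
  | zero q, v, s => some (q, 0 :: v, s)
  | succ q, v, s => some (q, [v.headI.succ], s)
  | tail q, v, s => some (q, v.tail, s)
  | dup q, v, s => some (q, v, v :: s)
  | swap q, v, s => some (q, s.headI, v :: s.tail)
  | cons q, v, s => some (q, s.headI.headI :: v, s.tail)
  | case q r, v, s => some (v.headI.rec (q, v.tail, s) fun y _ => (r, y :: v.tail, s))
  | halt, _, _ => none

/-- One step of the program `P`. Without an instruction at its address the machine idles. -/
def step (P : List Instr) (c : Config) : Option Config :=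
  match P[c.1]? with
  | some i => i.exec c.2.1 c.2.2
  | none => some c

theorem step_of_get {P : List Instr} {q : ℕ} {i : Instr} (h : P[q]? = some i) (v : List ℕ)
    (s : List (List ℕ)) : step P (q, v, s) = i.exec v s := by
  simp [step, h]

/-! ### Compilation of codes into programs. -/

open Turing.ToPartrec StateTransition

/-- The program contains a compiled version of the given code, with entry `a` and exit `e`. -/
def CodeAt (P : List Instr) : Code → ℕ → ℕ → Prop
  | Code.zero', a, e => P[a]? = some (zero e)
  | Code.succ, a, e => P[a]? = some (succ e)
  | Code.tail, a, e => P[a]? = some (tail e)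
  | Code.cons f g, a, e => ∃ a₁ b a₂ d, P[a]? = some (dup a₁) ∧ CodeAt P f a₁ b ∧
      P[b]? = some (swap a₂) ∧ CodeAt P g a₂ d ∧ P[d]? = some (cons e)
  | Code.comp f g, a, e => ∃ b, CodeAt P g a b ∧ CodeAt P f b e
  | Code.case f g, a, e => ∃ a₁ a₂, P[a]? = some (case a₁ a₂) ∧ CodeAt P f a₁ e ∧ CodeAt P g a₂ e
  | Code.fix f, a, e => ∃ b d, CodeAt P f a b ∧ P[b]? = some (case e d) ∧ P[d]? = some (tail a)

theorem getElem?_append_cons (A B : List Instr) (i : Instr) {n : ℕ} (h : A.length = n) :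
    (A ++ i :: B)[n]? = some i := by
  subst h; simp

/-- Every code can be compiled. The length of the program depends on the entry address only. -/
theorem exists_codeAt (c : Code) : ∀ a, ∃ n, ∀ e, ∃ L : List Instr, L.length = n ∧
    ∀ A B : List Instr, A.length = a → CodeAt (A ++ (L ++ B)) c a e := by
  induction c with
  | zero' =>
    exact fun a => ⟨1, fun e => ⟨[zero e], rfl, fun A B h => getElem?_append_cons _ _ _ h⟩⟩
  | succ =>
    exact fun a => ⟨1, fun e => ⟨[succ e], rfl, fun A B h => getElem?_append_cons _ _ _ h⟩⟩
  | tail =>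
    exact fun a => ⟨1, fun e => ⟨[tail e], rfl, fun A B h => getElem?_append_cons _ _ _ h⟩⟩
  | cons f g hf hg =>
    intro a
    obtain ⟨n₁, h₁⟩ := hf (a + 1)
    -- The length `n₁` is known before the exit is chosen, so the exit can be the address just
    -- behind the block.
    obtain ⟨L₁, l₁, h₁⟩ := h₁ (a + 1 + n₁)
    obtain ⟨n₂, h₂⟩ := hg (a + 1 + n₁ + 1)
    obtain ⟨L₂, l₂, h₂⟩ := h₂ (a + 1 + n₁ + 1 + n₂)
    refine ⟨1 + n₁ + 1 + n₂ + 1, fun e => ⟨dup (a + 1) :: (L₁ ++ swap (a + 1 + n₁ + 1) ::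
      (L₂ ++ [cons e])), by simp [l₁, l₂]; omega, fun A B hA => ⟨a + 1, a + 1 + n₁,
      a + 1 + n₁ + 1, a + 1 + n₁ + 1 + n₂, getElem?_append_cons _ _ _ hA, ?_, ?_, ?_, ?_⟩⟩⟩
    · simpa using h₁ (A ++ [dup (a + 1)]) (swap (a + 1 + n₁ + 1) :: (L₂ ++ cons e :: B))
        (by simp [hA])
    · simpa using getElem?_append_cons (A ++ dup (a + 1) :: L₁) (L₂ ++ cons e :: B)
        (swap (a + 1 + n₁ + 1)) (by simp [hA, l₁]; omega)
    · simpa using h₂ (A ++ dup (a + 1) :: (L₁ ++ [swap (a + 1 + n₁ + 1)])) (cons e :: B)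
        (by simp [hA, l₁]; omega)
    · simpa using getElem?_append_cons (A ++ dup (a + 1) :: (L₁ ++ swap (a + 1 + n₁ + 1) :: L₂)) B
        (cons e) (by simp [hA, l₁, l₂]; omega)
  | comp f g hf hg =>
    intro a
    obtain ⟨n₁, h₁⟩ := hg a
    obtain ⟨L₁, l₁, h₁⟩ := h₁ (a + n₁)
    obtain ⟨n₂, h₂⟩ := hf (a + n₁)
    refine ⟨n₁ + n₂, fun e => ?_⟩
    obtain ⟨L₂, l₂, h₂⟩ := h₂ e
    refine ⟨L₁ ++ L₂, by simp [l₁, l₂], fun A B hA => ⟨a + n₁, ?_, ?_⟩⟩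
    · simpa using h₁ A (L₂ ++ B) hA
    · simpa using h₂ (A ++ L₁) B (by simp [hA, l₁])
  | case f g hf hg =>
    intro a
    obtain ⟨n₁, h₁⟩ := hf (a + 1)
    obtain ⟨n₂, h₂⟩ := hg (a + 1 + n₁)
    refine ⟨1 + n₁ + n₂, fun e => ?_⟩
    obtain ⟨L₁, l₁, h₁⟩ := h₁ e
    obtain ⟨L₂, l₂, h₂⟩ := h₂ e
    refine ⟨case (a + 1) (a + 1 + n₁) :: (L₁ ++ L₂), by simp [l₁, l₂]; omega,
      fun A B hA => ⟨a + 1, a + 1 + n₁, getElem?_append_cons _ _ _ hA, ?_, ?_⟩⟩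
    · simpa using h₁ (A ++ [case (a + 1) (a + 1 + n₁)]) (L₂ ++ B) (by simp [hA])
    · simpa using h₂ (A ++ case (a + 1) (a + 1 + n₁) :: L₁) B (by simp [hA, l₁]; omega)
  | fix f hf =>
    intro a
    obtain ⟨n, h⟩ := hf a
    obtain ⟨L, l, h⟩ := h (a + n)
    refine ⟨n + 2, fun e => ⟨L ++ [case e (a + n + 1), tail a], by simp [l],
      fun A B hA => ⟨a + n, a + n + 1, ?_, ?_, ?_⟩⟩⟩
    · simpa using h A (case e (a + n + 1) :: tail a :: B) hA
    · simpa using getElem?_append_cons (A ++ L) (tail a :: B) (case e (a + n + 1))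
        (by simp [hA, l])
    · simpa using getElem?_append_cons (A ++ (L ++ [case e (a + n + 1)])) B (tail a)
        (by simp [hA, l]; omega)

/-! ### Simulation of the code evaluator by the program. -/

/-- At the given address and with the given stack, the program continues with the given
continuation. -/
def ContAt (P : List Instr) : Cont → ℕ → List (List ℕ) → Prop
  | Cont.halt, a, _ => ∃ e, P[a]? = some (tail e) ∧ P[e]? = some halt
  | Cont.cons₁ g as κ, a, s => ∃ a₁ b e s', P[a]? = some (swap a₁) ∧ CodeAt P g a₁ b ∧
      P[b]? = some (cons e) ∧ s = as :: s' ∧ ContAt P κ e s'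
  | Cont.cons₂ ns κ, a, s => ∃ e s', P[a]? = some (cons e) ∧ s = ns :: s' ∧ ContAt P κ e s'
  | Cont.comp f κ, a, s => ∃ e, CodeAt P f a e ∧ ContAt P κ e s
  | Cont.fix f κ, a, s => ∃ a₁ b e, CodeAt P f a₁ a ∧ P[a]? = some (case e b) ∧
      P[b]? = some (tail a₁) ∧ ContAt P κ e s

/-- The configurations of the program that represent a configuration of the code evaluator. -/
def Represents (P : List Instr) : Cfg → Config → Prop
  | Cfg.halt _, (a, _, _) => P[a]? = some halt
  | Cfg.ret κ v, (a, w, s) => v = w ∧ ContAt P κ a s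

theorem reaches₁_of_get {P : List Instr} {q : ℕ} {i : Instr} (h : P[q]? = some i) (v : List ℕ)
    (s : List (List ℕ)) {c : Config} (hc : i.exec v s = some c) :
    Reaches₁ (step P) (q, v, s) c :=
  Relation.TransGen.single (by simp [step_of_get h, hc])

/-- `stepNormal` descends into the code until a basic operation is done. For `comp` and `fix` the
descent only extends the continuation and costs no instruction; for `cons` the argument is saved on
the stack. At least one instruction is executed in every case, as `Respects` demands. -/
theorem represents_stepNormal {P : List Instr} (c : Code) : ∀ {κ : Cont} {a e : ℕ} (v : List ℕ)
    {s : List (List ℕ)}, CodeAt P c a e → ContAt P κ e s →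
      ∃ b, Represents P (stepNormal c κ v) b ∧ Reaches₁ (step P) (a, v, s) b := by
  induction c with
  | zero' => exact fun v s h hk => ⟨(_, _, _), ⟨rfl, hk⟩, reaches₁_of_get h _ _ rfl⟩
  | succ => exact fun v s h hk => ⟨(_, _, _), ⟨rfl, hk⟩, reaches₁_of_get h _ _ rfl⟩
  | tail => exact fun v s h hk => ⟨(_, _, _), ⟨rfl, hk⟩, reaches₁_of_get h _ _ rfl⟩
  | cons f g hf _ =>
    rintro κ a e v s ⟨a₁, b, a₂, d, h₁, h₂, h₃, h₄, h₅⟩ hk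
    obtain ⟨c, hc, hr⟩ := hf (κ := Cont.cons₁ g v κ) (s := v :: s) v h₂
      ⟨a₂, d, e, s, h₃, h₄, h₅, rfl, hk⟩
    exact ⟨c, hc, (reaches₁_of_get h₁ v s rfl).trans hr⟩
  | comp f g _ hg =>
    rintro κ a e v s ⟨b, h₁, h₂⟩ hk
    exact hg (κ := Cont.comp f κ) v h₁ ⟨e, h₂, hk⟩
  | case f g hf hg =>
    rintro κ a e v s ⟨a₁, a₂, h₁, h₂, h₃⟩ hk
    have key : ∀ c, (case a₁ a₂).exec v s = some c → _ := fun c => reaches₁_of_get h₁ v s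
    simp only [stepNormal]
    simp only [exec] at key
    cases hv : v.headI with
    | zero =>
      obtain ⟨c, hc, hr⟩ := hf (κ := κ) v.tail h₂ hk
      exact ⟨c, hc, (key _ (by simp [hv])).trans hr⟩
    | succ y =>
      obtain ⟨c, hc, hr⟩ := hg (κ := κ) (y :: v.tail) h₃ hk
      exact ⟨c, hc, (key _ (by simp [hv])).trans hr⟩
  | fix f hf =>
    rintro κ a e v s ⟨b, d, h₁, h₂, h₃⟩ hk
    exact hf (κ := Cont.fix f κ) v h₁ ⟨a, d, e, h₁, h₂, h₃, hk⟩

/-- `stepRet` may call itself on a shorter continuation, hence the induction on `κ`. In the `fix`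
case the branch on a positive head leaves the predecessor in front, which the `tail` instruction
removes before the next round. -/
theorem represents_stepRet {P : List Instr} (κ : Cont) : ∀ {a : ℕ} (v : List ℕ)
    {s : List (List ℕ)}, ContAt P κ a s →
      ∃ b, Represents P (stepRet κ v) b ∧ Reaches₁ (step P) (a, v, s) b := by
  induction κ with
  | halt =>
    rintro a v s ⟨e, h₁, h₂⟩
    exact ⟨(e, v.tail, s), h₂, reaches₁_of_get h₁ v s rfl⟩
  | cons₁ g as κ _ =>
    rintro a v s ⟨a₁, b, e, s', h₁, h₂, h₃, rfl, hk⟩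
    obtain ⟨c, hc, hr⟩ := represents_stepNormal g (κ := Cont.cons₂ v κ) (s := v :: s') as h₂
      ⟨e, s', h₃, rfl, hk⟩
    exact ⟨c, hc, (reaches₁_of_get h₁ v _ rfl).trans hr⟩
  | cons₂ ns κ ih =>
    rintro a v s ⟨e, s', h₁, rfl, hk⟩
    obtain ⟨c, hc, hr⟩ := ih (ns.headI :: v) hk
    exact ⟨c, hc, (reaches₁_of_get h₁ v _ rfl).trans hr⟩
  | comp f κ _ =>
    rintro a v s ⟨e, h₁, hk⟩
    exact represents_stepNormal f v h₁ hk
  | fix f κ ih =>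
    rintro a v s ⟨a₁, b, e, h₁, h₂, h₃, hk⟩
    have key : ∀ c, (case e b).exec v s = some c → _ := fun c => reaches₁_of_get h₂ v s
    simp only [exec] at key
    simp only [stepRet]
    cases hv : v.headI with
    | zero =>
      obtain ⟨c, hc, hr⟩ := ih v.tail hk
      exact ⟨c, by simpa using hc, (key _ (by simp [hv])).trans hr⟩
    | succ y =>
      obtain ⟨c, hc, hr⟩ := represents_stepNormal f (κ := Cont.fix f κ) v.tail h₁
        ⟨a₁, b, e, h₁, h₂, h₃, hk⟩
      refine ⟨c, by simpa using hc, (key _ (by simp [hv])).trans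
        ((reaches₁_of_get h₃ (y :: v.tail) s rfl).trans hr)⟩

theorem respects_represents (P : List Instr) :
    Respects Turing.ToPartrec.step (step P) (Represents P) := by
  rintro (v | ⟨κ, v⟩) ⟨a, w, s⟩ h
  · exact (step_of_get h w s).trans rfl
  · obtain ⟨rfl, h⟩ := h
    exact represents_stepRet κ v h

/-- Every code is simulated by a program. -/
theorem exists_program (c : Code) :
    ∃ (i : Instr) (P : List Instr), ∀ v,
      (eval (step (i :: P)) (0, v, [])).Dom ↔ (c.eval v).Dom := by
  obtain ⟨n, h⟩ := exists_codeAt c 0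
  obtain ⟨L, l, h⟩ := h n
  -- The evaluator makes a step from `Cont.halt` to `Cfg.halt`, which needs a machine step of its
  -- own; the `tail` instruction serves as a dummy for it.
  have h := h [] [tail (n + 1), halt] rfl
  simp only [List.nil_append] at h
  suffices hs : ∀ v, (eval (step (L ++ [tail (n + 1), halt])) (0, v, [])).Dom ↔ (c.eval v).Dom by
    -- The program is exhibited as nonempty because an empty disjunction would be ∅, which is not
    -- allowed inside a regex.
    obtain ⟨i, P, h⟩ := List.exists_cons_of_ne_nil (l := L ++ [tail (n + 1), halt]) (by simp)
    exact ⟨i, P, h ▸ hs⟩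
  intro v
  have hk : ContAt (L ++ [tail (n + 1), halt]) Cont.halt n [] :=
    ⟨n + 1, getElem?_append_cons _ _ _ l,
      by simpa using getElem?_append_cons (L ++ [tail (n + 1)]) [] halt (by simp [l])⟩
  obtain ⟨b, hb, hr⟩ := represents_stepNormal c v h hk
  rw [reaches_eval hr.to_reflTransGen, tr_eval_dom (respects_represents _) hb, stepNormal_eval]
  simp

/-- A program with undecidable halting problem. -/
theorem exists_undecidable_program :
    ∃ (i : Instr) (P : List Instr),
      ¬ ComputablePred fun n : ℕ => (eval (step (i :: P)) (0, [n], [])).Dom := by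
  -- The input is the number of a code, to be run on 0, so a program for this function is universal.
  have hu : Partrec fun n : ℕ => Nat.Partrec.Code.eval (Denumerable.ofNat Nat.Partrec.Code n) 0 :=
    Nat.Partrec.Code.eval_part.comp (Computable.ofNat _) (Computable.const 0)
  obtain ⟨c, hc⟩ := Code.exists_code (Nat.Partrec'.part_iff₁.2 hu)
  obtain ⟨i, P, hP⟩ := exists_program c
  refine ⟨i, P, fun h => ComputablePred.halting_problem 0 ?_⟩
  refine (ComputablePred.computable_of_manyOneReducible (q := _) ⟨Encodable.encode,
    Computable.encode, fun d => ?_⟩ h)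
  have := hc ⟨[Encodable.encode d], rfl⟩
  rw [hP, this]
  simp [List.Vector.head]

end Instr

end DetRegex
/-! ### A sufficient condition for determinism -/

namespace DetRegex

variable {k : ℕ}

/-- After a common prefix and two words of brackets, the words continue with different
terminals. -/
def Diverge (ρ₁ ρ₂ : List (RefSym k × ℕ)) : Prop :=
  ∃ (u γ₁ γ₂ s₁ s₂ : List (RefSym k × ℕ)) (a b : Fin k) (i j : ℕ), a ≠ b ∧
    (∀ m ∈ γ₁, m.1.IsBracket) ∧ (∀ m ∈ γ₂, m.1.IsBracket) ∧
    ρ₁ = u ++ (γ₁ ++ (RefSym.term a, i) :: s₁) ∧ ρ₂ = u ++ (γ₂ ++ (RefSym.term b, j) :: s₂)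

theorem Diverge.append {ρ₁ ρ₂ : List (RefSym k × ℕ)} (h : Diverge ρ₁ ρ₂)
    (t₁ t₂ : List (RefSym k × ℕ)) : Diverge (ρ₁ ++ t₁) (ρ₂ ++ t₂) := by
  obtain ⟨u, γ₁, γ₂, s₁, s₂, a, b, i, j, hab, h₁, h₂, rfl, rfl⟩ := h
  exact ⟨u, γ₁, γ₂, s₁ ++ t₁, s₂ ++ t₂, a, b, i, j, hab, h₁, h₂, by simp, by simp⟩

theorem Diverge.append_left {ρ₁ ρ₂ : List (RefSym k × ℕ)} (h : Diverge ρ₁ ρ₂)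
    (t : List (RefSym k × ℕ)) : Diverge (t ++ ρ₁) (t ++ ρ₂) := by
  obtain ⟨u, γ₁, γ₂, s₁, s₂, a, b, i, j, hab, h₁, h₂, rfl, rfl⟩ := h
  exact ⟨t ++ u, γ₁, γ₂, s₁, s₂, a, b, i, j, hab, h₁, h₂, by simp, by simp⟩

instance RefSym.decidableIsBracket : DecidablePred (RefSym.IsBracket (k := k))
  | term _ => isFalse id
  | var _ => isFalse id
  | op _ => isTrue trivial
  | cl _ => isTrue trivial

/-- The brackets at the beginning of a marked word, and the symbol that follows them. -/
def leading (ρ : List (RefSym k × ℕ)) :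
    List (RefSym k × ℕ) × Option (RefSym k × ℕ) :=
  (ρ.takeWhile fun m => decide m.1.IsBracket, (ρ.dropWhile fun m => decide m.1.IsBracket).head?)

theorem leading_cons {γ : List (RefSym k × ℕ)} {c : RefSym k × ℕ} (hγ : ∀ m ∈ γ, m.1.IsBracket)
    (hc : ¬ c.1.IsBracket) (s : List (RefSym k × ℕ)) : leading (γ ++ c :: s) = (γ, some c) := by
  have hγ' : ∀ m ∈ γ, decide m.1.IsBracket = true := fun m hm => by simpa using hγ m hm
  simp [leading, List.takeWhile_append_of_pos hγ', List.dropWhile_append_of_pos hγ', hc]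

theorem leading_of_brackets {γ : List (RefSym k × ℕ)} (hγ : ∀ m ∈ γ, m.1.IsBracket) :
    leading γ = (γ, none) := by
  have hγ' : ∀ m ∈ γ, decide m.1.IsBracket = true := fun m hm => by simpa using hγ m hm
  have := List.takeWhile_append_of_pos (l₂ := []) hγ'
  have h2 := List.dropWhile_append_of_pos (l₂ := []) hγ'
  simp only [List.append_nil, List.takeWhile_nil, List.dropWhile_nil] at this h2
  simp [leading, this, h2]

theorem brackets_or_split (t : List (RefSym k × ℕ)) : (∀ m ∈ t, m.1.IsBracket) ∨
    ∃ γ c s, (∀ m ∈ γ, m.1.IsBracket) ∧ ¬ c.1.IsBracket ∧ t = γ ++ c :: s := by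
  induction t with
  | nil => simp
  | cons d t ih =>
    by_cases hd : d.1.IsBracket
    · rcases ih with h | ⟨γ, c, s, hγ, hc, rfl⟩
      · left; simpa using ⟨hd, by simpa using h⟩
      · exact .inr ⟨d :: γ, c, s, by simpa using ⟨hd, by simpa using hγ⟩, hc, rfl⟩
    · exact .inr ⟨[], d, t, by simp, hd, rfl⟩

theorem brackets_append {γ δ : List (RefSym k × ℕ)} (hγ : ∀ m ∈ γ, m.1.IsBracket)
    (hδ : ∀ m ∈ δ, m.1.IsBracket) : ∀ m ∈ γ ++ δ, m.1.IsBracket := by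
  intro m hm
  rcases List.mem_append.1 hm with h | h
  exacts [hγ m h, hδ m h]

/-- Two diverging words with another common prefix either diverge within the rest, or the rests
begin in the same way. -/
theorem Diverge.leading_append {r σ₁ σ₂ : List (RefSym k × ℕ)}
    (h : Diverge (r ++ σ₁) (r ++ σ₂)) :
    (∃ a b i j, a ≠ b ∧ (leading σ₁).2 = some (RefSym.term a, i) ∧
      (leading σ₂).2 = some (RefSym.term b, j)) ∨
    (leading σ₁ = leading σ₂ ∧ (leading σ₁).2.isSome) := by
  obtain ⟨u, γ₁, γ₂, s₁, s₂, a, b, i, j, hab, h₁, h₂, e₁, e₂⟩ := h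
  have ta : ¬ (RefSym.term a : RefSym k).IsBracket := id
  have tb : ¬ (RefSym.term b : RefSym k).IsBracket := id
  -- Either `r` ends within the common prefix `u`, or `u` is a prefix of `r`; `t` is the difference.
  rcases List.append_eq_append_iff.1 e₁ with ⟨t, rfl, f₁⟩ | ⟨t, rfl, f₁⟩
  · rw [List.append_assoc, List.append_cancel_left_eq] at e₂
    subst f₁ e₂
    rcases brackets_or_split t with ht | ⟨γ, c, s, hγ, hc, rfl⟩
    · left
      refine ⟨a, b, i, j, hab, ?_, ?_⟩
      · rw [← List.append_assoc, leading_cons (brackets_append ht h₁) ta]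
      · rw [← List.append_assoc, leading_cons (brackets_append ht h₂) tb]
    · right
      simp only [List.append_assoc, List.cons_append]
      rw [leading_cons hγ hc, leading_cons hγ hc]
      simp
  · rw [List.append_assoc, List.append_cancel_left_eq] at e₂
    have g₁ := congrArg leading f₁
    have g₂ := congrArg leading e₂
    rw [leading_cons h₁ ta] at g₁
    rw [leading_cons h₂ tb] at g₂
    rcases brackets_or_split t with ht | ⟨γ, c, s, hγ, hc, rfl⟩
    · rcases brackets_or_split σ₁ with hσ | ⟨δ, d, s, hδ, hd, rfl⟩
      · rw [leading_of_brackets (brackets_append ht hσ)] at g₁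
        simp at g₁
      rcases brackets_or_split σ₂ with hσ | ⟨δ', d', s', hδ', hd', rfl⟩
      · rw [leading_of_brackets (brackets_append ht hσ)] at g₂
        simp at g₂
      rw [← List.append_assoc, leading_cons (brackets_append ht hδ) hd] at g₁
      rw [← List.append_assoc, leading_cons (brackets_append ht hδ') hd'] at g₂
      simp only [Prod.mk.injEq, Option.some.injEq] at g₁ g₂
      left
      refine ⟨a, b, i, j, hab, ?_, ?_⟩
      · rw [leading_cons hδ hd, g₁.2]
      · rw [leading_cons hδ' hd', g₂.2]
    -- Here `r` already contains the first symbol that is not a bracket after `u`, so both diverging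
    -- terminals would be this symbol.
    · simp only [List.append_assoc, List.cons_append] at g₁ g₂
      rw [leading_cons hγ hc] at g₁ g₂
      simp only [Prod.mk.injEq, Option.some.injEq] at g₁ g₂
      have := g₁.2.trans g₂.2
      simp [hab] at this

/-! ### Closure properties of prefix-free marked languages. -/

/-- Any two different words diverge. -/
def PairwiseDiverge (L : Language (RefSym k × ℕ)) : Prop :=
  ∀ ρ₁ ∈ L, ∀ ρ₂ ∈ L, ρ₁ = ρ₂ ∨ Diverge ρ₁ ρ₂

/-- Divergence happens inside both words and survives any continuation. So different first factors
settle the matter, and nothing is required of the beginning of the second factor. -/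
theorem PairwiseDiverge.mul {L M : Language (RefSym k × ℕ)} (hL : PairwiseDiverge L)
    (hM : PairwiseDiverge M) : PairwiseDiverge (L * M) := by
  rintro _ ⟨u, hu, v, hv, rfl⟩ _ ⟨u', hu', v', hv', rfl⟩
  rcases hL u hu u' hu' with rfl | h
  · rcases hM v hv v' hv' with rfl | h
    · exact .inl rfl
    · exact .inr (h.append_left u)
  · exact .inr (h.append v v')

/-- Every word of the language begins, up to brackets, with the terminal `a`. -/
def Begins (a : Fin k) (L : Language (RefSym k × ℕ)) : Prop :=
  ∀ ρ ∈ L, ∃ γ i s, (∀ m ∈ γ, m.1.IsBracket) ∧ ρ = γ ++ (RefSym.term a, i) :: s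

theorem Begins.mul {a : Fin k} {L : Language (RefSym k × ℕ)} (hL : Begins a L)
    (M : Language (RefSym k × ℕ)) : Begins a (L * M) := by
  rintro _ ⟨u, hu, v, hv, rfl⟩
  obtain ⟨γ, i, s, hγ, rfl⟩ := hL u hu
  exact ⟨γ, i, s ++ v, hγ, by simp⟩

theorem Begins.diverge {a b : Fin k} {L M : Language (RefSym k × ℕ)} (hL : Begins a L)
    (hM : Begins b M) (hab : a ≠ b) {ρ₁ ρ₂ : List (RefSym k × ℕ)} (h₁ : ρ₁ ∈ L) (h₂ : ρ₂ ∈ M) :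
    Diverge ρ₁ ρ₂ := by
  obtain ⟨γ, i, s, hγ, rfl⟩ := hL _ h₁
  obtain ⟨δ, j, t, hδ, rfl⟩ := hM _ h₂
  exact ⟨[], γ, δ, s, t, a, b, i, j, hab, hγ, hδ, rfl, rfl⟩

theorem PairwiseDiverge.add {a b : Fin k} {L M : Language (RefSym k × ℕ)}
    (hL : PairwiseDiverge L) (hM : PairwiseDiverge M) (ha : Begins a L) (hb : Begins b M)
    (hab : a ≠ b) : PairwiseDiverge (L + M) := by
  rintro ρ₁ (h₁ | h₁) ρ₂ (h₂ | h₂)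
  · exact hL _ h₁ _ h₂
  · exact .inr (ha.diverge hb hab h₁ h₂)
  · exact .inr (hb.diverge ha hab.symm h₁ h₂)
  · exact hM _ h₁ _ h₂

/-- At each boundary between rounds the next terminal, `a` or `b`, tells whether another round
follows. Common rounds are stripped by induction. -/
theorem PairwiseDiverge.kstar_mul {a b : Fin k} {L M : Language (RefSym k × ℕ)}
    (hL : PairwiseDiverge L) (hM : PairwiseDiverge M) (ha : Begins a L) (hb : Begins b M)
    (hab : a ≠ b) : PairwiseDiverge (KStar.kstar L * M) := by
  rintro _ ⟨_, ⟨S, rfl, hS⟩, v, hv, rfl⟩ _ ⟨_, ⟨S', rfl, hS'⟩, v', hv', rfl⟩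
  induction S generalizing S' with
  | nil =>
    cases S' with
    | nil => simpa using hM v hv v' hv'
    | cons y S' =>
      have := (hb.diverge ha hab.symm hv (hS' y (by simp))).append [] (S'.flatten ++ v')
      exact .inr (by simpa using this)
  | cons x S ih =>
    have hx := hS x (by simp)
    cases S' with
    | nil =>
      have := (ha.diverge hb hab hx hv').append (S.flatten ++ v) []
      exact .inr (by simpa using this)
    | cons y S' =>
      rcases hL x hx y (hS' y (by simp)) with rfl | h
      · rcases ih (fun z hz => hS z (by simp [hz])) S' (fun z hz => hS' z (by simp [hz]))
          with h | h
        · exact .inl (by simpa using h)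
        · exact .inr (by simpa using h.append_left x)
      · exact .inr (by simpa using h.append (S.flatten ++ v) (S'.flatten ++ v'))

namespace Regex

/-- Marked ref-words of the regex diverge pairwise, however the marking is shifted. -/
def PrefixFree (α : Regex k) : Prop := ∀ n, PairwiseDiverge (α.toRef.markFrom n).lang

/-- Every marked ref-word of the regex begins, up to brackets, with the terminal `a`. -/
def BeginsWith (a : Fin k) (α : Regex k) : Prop := ∀ n, Begins a (α.toRef.markFrom n).lang

/-- After a common prefix, the two rests have the same leading brackets and the same next marked
symbol (or both end), or they lead to different terminals. Each of the four conflicts contradicts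
both possibilities. -/
theorem PrefixFree.not_isNondeterministic {α : Regex k} (h : α.PrefixFree) :
    ¬ α.IsNondeterministic := by
  rintro ⟨ρ₁, h₁, ρ₂, h₂, r, s₁, s₂, γ₁, γ₂, hγ₁, hγ₂, hc⟩
  have key : ∀ σ₁ σ₂ : List (RefSym k × ℕ), ρ₁ = r ++ σ₁ → ρ₂ = r ++ σ₂ →
      leading σ₁ = leading σ₂ ∨ (∃ a b i j, a ≠ b ∧ (leading σ₁).2 = some (RefSym.term a, i) ∧
        (leading σ₂).2 = some (RefSym.term b, j)) := by
    rintro σ₁ σ₂ rfl rfl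
    rcases h 1 _ h₁ _ h₂ with h | h
    · exact .inl (by rw [List.append_cancel_left h])
    · exact h.leading_append.symm.imp And.left id
  rcases hc with ⟨a, i, j, hij, e₁, e₂⟩ | ⟨x, χ, i, j, hχ, hij, e₁, e₂⟩ | ⟨χ, i, hχ, hγ, e₁, e₂⟩ |
    ⟨hγ, e₁, e₂⟩
  · have := key _ _ (by simpa using e₁) (by simpa using e₂)
    rw [leading_cons hγ₁ (c := (RefSym.term a, i)) id, leading_cons hγ₂ (c := (RefSym.term a, j)) id] at this
    simp [hij] at this
  · have := key _ _ (by simpa using e₁) (by simpa using e₂)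
    rw [leading_cons hγ₁ (c := (RefSym.var x, i)) id, leading_cons hγ₂ (c := (χ, j)) hχ] at this
    simp [hij] at this
  · have := key _ _ (by simpa using e₁) (by simpa using e₂)
    rw [leading_cons hγ₁ hχ, leading_cons hγ₂ hχ] at this
    simp [hγ] at this
    grind
  · have := key _ _ e₁ e₂
    rw [leading_of_brackets hγ₁, leading_of_brackets hγ₂] at this
    simp [hγ] at this

theorem prefixFree_eps : (eps : Regex k).PrefixFree := by
  intro n ρ₁ h₁ ρ₂ h₂
  exact .inl (h₁.trans h₂.symm)

theorem prefixFree_term (a : Fin k) : (term a).PrefixFree := by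
  intro n ρ₁ h₁ ρ₂ h₂
  exact .inl (h₁.trans h₂.symm)

theorem prefixFree_ref (x : ℕ) : (ref x : Regex k).PrefixFree := by
  intro n ρ₁ h₁ ρ₂ h₂
  exact .inl (h₁.trans h₂.symm)

theorem PrefixFree.cat {α β : Regex k} (hα : α.PrefixFree) (hβ : β.PrefixFree) :
    (cat α β).PrefixFree := fun n => (hα n).mul (hβ _)

theorem PrefixFree.alt {α β : Regex k} {a b : Fin k} (hα : α.PrefixFree) (hβ : β.PrefixFree)
    (ha : α.BeginsWith a) (hb : β.BeginsWith b) (hab : a ≠ b) : (alt α β).PrefixFree :=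
  fun n => (hα n).add (hβ _) (ha n) (hb _) hab

theorem PrefixFree.bind {α : Regex k} (hα : α.PrefixFree) (x : ℕ) : (bind x α).PrefixFree := by
  have h : ∀ p : RefSym k × ℕ, PairwiseDiverge ({[p]} : Language (RefSym k × ℕ)) :=
    fun p ρ₁ h₁ ρ₂ h₂ => .inl (h₁.trans h₂.symm)
  exact fun n => (h _).mul ((hα _).mul (h _))

theorem beginsWith_term (a : Fin k) : (term a).BeginsWith a := by
  rintro n _ rfl
  exact ⟨[], n, [], by simp, rfl⟩

theorem BeginsWith.cat {a : Fin k} {α : Regex k} (h : α.BeginsWith a) (β : Regex k) :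
    (cat α β).BeginsWith a := fun n => (h n).mul _

theorem BeginsWith.bind {a : Fin k} {α : Regex k} (h : α.BeginsWith a) (x : ℕ) :
    (bind x α).BeginsWith a := by
  rintro n _ ⟨_, rfl, v, hv, rfl⟩
  obtain ⟨γ, i, s, hγ, rfl⟩ := (h _).mul _ v hv
  exact ⟨(RefSym.op x, n) :: γ, i, s, by simpa [RefSym.IsBracket] using hγ, rfl⟩

/-- Any number of repetitions of `α`, followed by `β`. -/
def loop (α β : Regex k) : Regex k := cat (alt (plus α) eps) β

/-- The optional repetition is not treated on its own, since ε diverges from no word; it becomes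
prefix-free only together with the delimiter `β`. -/
theorem PrefixFree.loop {α β : Regex k} {a b : Fin k} (hα : α.PrefixFree) (hβ : β.PrefixFree)
    (ha : α.BeginsWith a) (hb : β.BeginsWith b) (hab : a ≠ b) : (loop α β).PrefixFree := by
  intro n
  have := (hα n).kstar_mul (hβ (n + ((plus α).alt eps).toRef.occ)) (ha n) (hb _) hab
  rw [← Language.one_add_self_mul_kstar_eq_kstar, add_comm] at this
  exact this

end Regex

end DetRegex
/-! ### Compositional semantics of regex without nested bindings -/

namespace DetRegex

variable {k : ℕ}

theorem filterMap_letter_terms (w : List (Fin k)) :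
    List.filterMap (fun a => (RefSym.term a).letter) w = w :=
  (congrFun (congrArg List.filterMap (rfl : _ = some)) w).trans List.filterMap_some

theorem lastValue_op (x y : ℕ) (q : List (RefSym k)) :
    lastValue x (RefSym.op y :: q) = lastValue x q := by
  simp [lastValue]

theorem lastValue_terms (x : ℕ) (w : List (Fin k)) (q : List (RefSym k)) :
    lastValue x ((w.map RefSym.term).reverse ++ q) = lastValue x q := by
  have h : ∀ s ∈ (w.map RefSym.term).reverse, decide (s ≠ RefSym.cl x) = true := by
    simp
  rw [lastValue, List.dropWhile_append_of_pos h, lastValue]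

theorem lastValue_cl_of_ne {x y : ℕ} (h : x ≠ y) (q : List (RefSym k)) :
    lastValue x (RefSym.cl y :: q) = lastValue x q := by
  simp [lastValue, h.symm]

theorem lastValue_cl_self (x : ℕ) (w : List (Fin k)) (q : List (RefSym k)) :
    lastValue x (RefSym.cl x :: ((w.map RefSym.term).reverse ++ RefSym.op x :: q)) = w := by
  have h : ∀ s ∈ (w.map RefSym.term).reverse, decide (s ≠ RefSym.op x) = true := by
    simp
  rw [lastValue, List.dropWhile_cons_of_neg (by simp), List.tail_cons,
    List.takeWhile_append_of_pos h]
  simp [filterMap_letter_terms]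

/-- The processed part of a ref-word in reversed order, after processing `r`. -/
def process : List (RefSym k) → List (RefSym k) → List (RefSym k)
  | q, [] => q
  | q, RefSym.var x :: r => process (((lastValue x q).map RefSym.term).reverse ++ q) r
  | q, RefSym.term a :: r => process (RefSym.term a :: q) r
  | q, RefSym.op x :: r => process (RefSym.op x :: q) r
  | q, RefSym.cl x :: r => process (RefSym.cl x :: q) r

theorem resolve_eq_process (r : List (RefSym k)) : ∀ q, resolve q r = (process q r).reverse := by
  induction r with
  | nil => exact fun _ => rfl
  | cons s r ih => rintro q; cases s <;> exact ih _

theorem process_append (r t : List (RefSym k)) :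
    ∀ q, process q (r ++ t) = process (process q r) t := by
  induction r with
  | nil => exact fun _ => rfl
  | cons s r ih => rintro q; cases s <;> exact ih _

theorem process_terms (w : List (Fin k)) :
    ∀ q, process q (w.map RefSym.term) = (w.map RefSym.term).reverse ++ q := by
  induction w with
  | nil => exact fun _ => rfl
  | cons a w ih => intro q; simp [process, ih]

/-- The terminals of a ref-word in reversed order. -/
def letters (q : List (RefSym k)) : List (Fin k) := q.reverse.filterMap RefSym.letter

theorem letters_cons (s : RefSym k) (q : List (RefSym k)) :
    letters (s :: q) = letters q ++ s.letter.toList := by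
  cases h : s.letter <;> simp [letters, h]

theorem letters_terms (w : List (Fin k)) (q : List (RefSym k)) :
    letters ((w.map RefSym.term).reverse ++ q) = letters q ++ w := by
  simp [letters, filterMap_letter_terms]

/-- The values of the variables. -/
abbrev Env (k : ℕ) : Type := ℕ → List (Fin k)

/-- The values of the variables after a ref-word in reversed order. -/
def env (q : List (RefSym k)) : Env k := fun x => lastValue x q

/-- Any number of repetitions of a relation between environments that is labelled by words. -/
inductive Repeats (R : Env k → List (Fin k) → Env k → Prop) :
    Env k → List (Fin k) → Env k → Prop
  | nil (e) : Repeats R e [] e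
  | cons {e w e₁ w' e₂} : R e w e₁ → Repeats R e₁ w' e₂ → Repeats R e (w ++ w') e₂

namespace Regex

/-- The regex matches the word, starting and ending with the given values of the variables. -/
def Matches : Regex k → Env k → List (Fin k) → Env k → Prop
  | empty, _, _, _ => False
  | eps, e, w, e' => w = [] ∧ e' = e
  | term a, e, w, e' => w = [a] ∧ e' = e
  | ref x, e, w, e' => w = e x ∧ e' = e
  | cat α β, e, w, e' => ∃ w₁ w₂ e₁, α.Matches e w₁ e₁ ∧ β.Matches e₁ w₂ e' ∧ w = w₁ ++ w₂
  | alt α β, e, w, e' => α.Matches e w e' ∨ β.Matches e w e'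
  | plus α, e, w, e' => ∃ w₁ w₂ e₁, α.Matches e w₁ e₁ ∧ Repeats α.Matches e₁ w₂ e' ∧ w = w₁ ++ w₂
  | bind x α, e, w, e' => (∃ e₁, α.Matches e w e₁) ∧ e' = Function.update e x w

/-- No variables occur in bindings. -/
def Flat : Regex k → Prop
  | cat α β => α.Flat ∧ β.Flat
  | alt α β => α.Flat ∧ β.Flat
  | plus α => α.Flat
  | bind _ α => α.vars = ∅
  | _ => True

theorem flat_of_vars_eq_empty {α : Regex k} (h : α.vars = ∅) : α.Flat := by
  induction α with
  | cat α β hα hβ =>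
    rw [vars, Finset.union_eq_empty] at h
    exact ⟨hα h.1, hβ h.2⟩
  | alt α β hα hβ =>
    rw [vars, Finset.union_eq_empty] at h
    exact ⟨hα h.1, hβ h.2⟩
  | plus α hα => exact hα h
  | bind x α => simp [vars] at h
  | _ => trivial

theorem exists_terms_of_vars_eq_empty {α : Regex k} (h : α.vars = ∅) :
    ∀ r ∈ α.refLang, ∃ w, r = List.map RefSym.term w := by
  induction α with
  | empty => intro r hr; exact hr.elim
  | eps => intro r hr; exact ⟨[], hr⟩
  | term a => intro r hr; exact ⟨[a], hr⟩
  | ref x => simp [vars] at h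
  | bind x α => simp [vars] at h
  | cat α β hα hβ =>
    rw [vars, Finset.union_eq_empty] at h
    rintro _ ⟨r, hr, t, ht, rfl⟩
    obtain ⟨v, rfl⟩ := hα h.1 r hr
    obtain ⟨w, rfl⟩ := hβ h.2 t ht
    exact ⟨v ++ w, by simp⟩
  | alt α β hα hβ =>
    rw [vars, Finset.union_eq_empty] at h
    rintro r (hr | hr)
    exacts [hα h.1 r hr, hβ h.2 r hr]
  | plus α hα =>
    rintro _ ⟨r, hr, _, ⟨S, rfl, hS⟩, rfl⟩
    have hS' : ∃ w, S.flatten = List.map RefSym.term w := by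
      induction S with
      | nil => exact ⟨[], rfl⟩
      | cons t S ih =>
        obtain ⟨v, hv⟩ := hα h t (hS t (by simp))
        obtain ⟨w, hw⟩ := ih fun y hy => hS y (by simp [hy])
        exact ⟨v ++ w, by simp [hv, hw]⟩
    obtain ⟨v, rfl⟩ := hα h r hr
    obtain ⟨w, hw⟩ := hS'
    exact ⟨v ++ w, by simp [hw]⟩

/-- Some ref-word of the language `L`, processed after `q`, yields the word `w` and the
environment `e`. -/
def Yields (L : Language (RefSym k)) (q : List (RefSym k)) (w : List (Fin k)) (e : Env k) : Prop :=
  ∃ r ∈ L, env (process q r) = e ∧ letters (process q r) = letters q ++ w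

/-- The relation `R` is understood only at environments of the form `env q`, so both inductions
carry along a prefix that realizes the current environment. -/
theorem repeats_iff {L : Language (RefSym k)} {R : Env k → List (Fin k) → Env k → Prop}
    (h : ∀ q w e, R (env q) w e ↔ Yields L q w e)
    (hL : ∀ r ∈ L, ∀ q, ∃ w, letters (process q r) = letters q ++ w)
    (q : List (RefSym k)) (w : List (Fin k)) (e : Env k) :
    Repeats R (env q) w e ↔ Yields (KStar.kstar L) q w e := by
  constructor
  · generalize hq : env q = e₀
    intro hr
    induction hr generalizing q with
    | nil => exact ⟨[], ⟨[], rfl, by simp⟩, hq, by simp [process]⟩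
    | cons h₁ _ ih =>
      subst hq
      obtain ⟨r, hr, he, hl⟩ := (h _ _ _).1 h₁
      obtain ⟨t, ht, he', hl'⟩ := ih (process q r) he
      refine ⟨r ++ t, ?_, by rw [process_append, he'], by
        rw [process_append, hl', hl, List.append_assoc]⟩
      rw [← Language.one_add_self_mul_kstar_eq_kstar]
      exact .inr ⟨r, hr, t, ht, rfl⟩
  · rintro ⟨_, ⟨S, rfl, hS⟩, rfl, hl⟩
    induction S generalizing q w with
    | nil =>
      obtain rfl : w = [] := by simpa [process] using hl
      exact .nil _
    | cons r S ih =>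
      have hr := hS r (by simp)
      obtain ⟨v, hv⟩ := hL r hr q
      rw [List.flatten_cons, process_append] at hl ⊢
      have hS' : ∀ y ∈ S, y ∈ L := fun y hy => hS y (by simp [hy])
      have hex : ∃ u, letters (process (process q r) S.flatten) =
          letters (process q r) ++ u := by
        clear hl ih
        generalize process q r = p
        induction S generalizing p with
        | nil => exact ⟨[], by simp [process]⟩
        | cons t S ih =>
          obtain ⟨u₁, h₁⟩ := hL t (hS' t (by simp)) p
          obtain ⟨u₂, h₂⟩ := ih (fun y hy => hS y (by simp at hy ⊢; tauto))
            (fun y hy => hS' y (by simp [hy])) (process p t)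
          exact ⟨u₁ ++ u₂, by rw [List.flatten_cons, process_append, h₂, h₁, List.append_assoc]⟩
      obtain ⟨u, hu⟩ := hex
      have hw : w = v ++ u := by
        rw [hu, hv, List.append_assoc] at hl
        exact (List.append_cancel_left hl).symm
      subst hw
      exact .cons ((h _ _ _).2 ⟨r, hr, rfl, hv⟩) (ih _ _ hS' hu)

/-- Processing only adds symbols to `q`. This permits splitting the word of a concatenation at the
boundary of the two ref-words. -/
theorem exists_letters_process (r : List (RefSym k)) :
    ∀ q, ∃ w, letters (process q r) = letters q ++ w := by
  induction r with
  | nil => exact fun q => ⟨[], by simp [process]⟩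
  | cons s r ih =>
    intro q
    have key : ∀ l : List (RefSym k), ∃ w, letters (process (l ++ q) r) = letters q ++ w := by
      intro l
      obtain ⟨w, hw⟩ := ih (l ++ q)
      exact ⟨letters l ++ w, by rw [hw]; simp [letters]⟩
    cases s with
    | term a => exact key [RefSym.term a]
    | var x => exact key _
    | op x => exact key [RefSym.op x]
    | cl x => exact key [RefSym.cl x]

theorem yields_mul {L M : Language (RefSym k)} {q : List (RefSym k)} {w : List (Fin k)}
    {e : Env k} : Yields (L * M) q w e ↔ ∃ w₁ w₂, ∃ r ∈ L, letters (process q r) = letters q ++ w₁ ∧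
      Yields M (process q r) w₂ e ∧ w = w₁ ++ w₂ := by
  constructor
  · rintro ⟨_, ⟨r, hr, t, ht, rfl⟩, he, hl⟩
    obtain ⟨w₁, h₁⟩ := exists_letters_process r q
    obtain ⟨w₂, h₂⟩ := exists_letters_process t (process q r)
    rw [process_append] at he hl
    refine ⟨w₁, w₂, r, hr, h₁, ⟨t, ht, he, h₂⟩, ?_⟩
    rw [h₂, h₁, List.append_assoc] at hl
    exact (List.append_cancel_left hl).symm
  · rintro ⟨w₁, w₂, r, hr, h₁, ⟨t, ht, he, h₂⟩, rfl⟩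
    exact ⟨r ++ t, ⟨r, hr, t, ht, rfl⟩, by rw [process_append, he],
      by rw [process_append, h₂, h₁, List.append_assoc]⟩

theorem mul_iff {L M : Language (RefSym k)} {R S : Env k → List (Fin k) → Env k → Prop}
    (hR : ∀ q w e, R (env q) w e ↔ Yields L q w e) (hS : ∀ q w e, S (env q) w e ↔ Yields M q w e)
    (q : List (RefSym k)) (w : List (Fin k)) (e : Env k) :
    (∃ w₁ w₂ e₁, R (env q) w₁ e₁ ∧ S e₁ w₂ e ∧ w = w₁ ++ w₂) ↔ Yields (L * M) q w e := by
  rw [yields_mul]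
  constructor
  · rintro ⟨w₁, w₂, e₁, h₁, h₂, rfl⟩
    obtain ⟨r, hr, rfl, hl⟩ := (hR _ _ _).1 h₁
    exact ⟨w₁, w₂, r, hr, hl, (hS _ _ _).1 h₂, rfl⟩
  · rintro ⟨w₁, w₂, r, hr, hl, h, rfl⟩
    exact ⟨w₁, w₂, _, (hR _ _ _).2 ⟨r, hr, rfl, hl⟩, (hS _ _ _).2 h, rfl⟩

theorem yields_singleton {r q : List (RefSym k)} {w : List (Fin k)} {e : Env k} :
    Yields {r} q w e ↔ env (process q r) = e ∧ letters (process q r) = letters q ++ w :=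
  ⟨by rintro ⟨_, rfl, h⟩; exact h, fun h => ⟨r, rfl, h⟩⟩

theorem env_terms (w : List (Fin k)) (q : List (RefSym k)) :
    env ((w.map RefSym.term).reverse ++ q) = env q :=
  funext fun x => lastValue_terms x w q

theorem env_bind (x : ℕ) (w : List (Fin k)) (q : List (RefSym k)) :
    env (RefSym.cl x :: ((w.map RefSym.term).reverse ++ RefSym.op x :: q)) =
      Function.update (env q) x w := by
  funext y
  by_cases h : y = x
  · subst h
    simpa [env] using lastValue_cl_self y w q
  · rw [Function.update_of_ne h]
    simp only [env]
    rw [lastValue_cl_of_ne h, lastValue_terms, lastValue_op]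

/-- A later reference sees nothing of `q` but `env q`. Flatness enters at bindings: the content is a
word of terminals, which is literally what `lastValue` retrieves. -/
theorem matches_iff {α : Regex k} (hα : α.Flat) : ∀ (q : List (RefSym k)) (w : List (Fin k))
    (e : Env k), α.Matches (env q) w e ↔ Yields α.refLang q w e := by
  induction α with
  | empty => exact fun q w e => ⟨False.elim, fun ⟨_, h, _⟩ => h.elim⟩
  | eps =>
    intro q w e
    refine Iff.trans ?_ (yields_singleton (r := [])).symm
    simp [Matches, process, and_comm, eq_comm]
  | term a =>
    intro q w e
    refine Iff.trans ?_ (yields_singleton (r := [RefSym.term a])).symm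
    have h₁ := env_terms [a] q
    have h₂ := letters_terms [a] q
    simp only [List.map_cons, List.map_nil, List.reverse_singleton, List.cons_append,
      List.nil_append] at h₁ h₂
    simp [Matches, process, and_comm, eq_comm, h₁, h₂]
  | ref x =>
    intro q w e
    refine Iff.trans ?_ (yields_singleton (r := [RefSym.var x])).symm
    simp only [Matches, process, env_terms, letters_terms, List.append_cancel_left_eq]
    simp only [env, eq_comm, and_comm]
  | cat α β iα iβ => exact mul_iff (iα hα.1) (iβ hα.2)
  | alt α β iα iβ =>
    intro q w e
    refine (or_congr (iα hα.1 q w e) (iβ hα.2 q w e)).trans ⟨?_, ?_⟩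
    · rintro (⟨r, hr, h⟩ | ⟨r, hr, h⟩)
      exacts [⟨r, .inl hr, h⟩, ⟨r, .inr hr, h⟩]
    · rintro ⟨r, hr | hr, h⟩
      exacts [.inl ⟨r, hr, h⟩, .inr ⟨r, hr, h⟩]
  | plus α iα =>
    exact mul_iff (iα hα) (repeats_iff (iα hα) fun r _ => exists_letters_process r)
  | bind x α iα =>
    intro q w e
    have hop : env (RefSym.op x :: q) = env q := funext fun y => lastValue_op y x q
    have key : ∀ v : List (Fin k), process q (RefSym.op x :: (v.map RefSym.term ++ [RefSym.cl x])) =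
        RefSym.cl x :: ((v.map RefSym.term).reverse ++ RefSym.op x :: q) := fun v => by
      simp only [process, process_append, process_terms]
    have hlet : ∀ v : List (Fin k),
        letters (RefSym.cl x :: ((v.map RefSym.term).reverse ++ RefSym.op x :: q)) =
          letters q ++ v := fun v => by
      rw [letters_cons, letters_terms, letters_cons]
      simp [RefSym.letter]
    constructor
    · rintro ⟨⟨e₁, h⟩, rfl⟩
      rw [← hop, iα (flat_of_vars_eq_empty hα)] at h
      obtain ⟨r, hr, -, hl⟩ := h
      obtain ⟨v, rfl⟩ := exists_terms_of_vars_eq_empty hα r hr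
      rw [process_terms, letters_terms] at hl
      obtain rfl := List.append_cancel_left hl
      exact ⟨_, ⟨_, rfl, _, ⟨_, hr, _, rfl, rfl⟩, rfl⟩, (congrArg env (key _)).trans (env_bind _ _ _),
        (congrArg letters (key _)).trans (hlet _)⟩
    · rintro ⟨_, ⟨_, rfl, _, ⟨r, hr, _, rfl, rfl⟩, rfl⟩, he, hl⟩
      obtain ⟨v, rfl⟩ := exists_terms_of_vars_eq_empty hα r hr
      have he := (congrArg env (key v)).symm.trans he
      have hl := (congrArg letters (key v)).symm.trans hl
      rw [hlet, List.append_cancel_left_eq] at hl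
      subst hl
      rw [env_bind] at he
      refine ⟨⟨env q, ?_⟩, he.symm⟩
      have := (iα (flat_of_vars_eq_empty hα) (RefSym.op x :: q) v (env q)).2
        ⟨_, hr, by rw [process_terms, env_terms, hop], by rw [process_terms, letters_terms]⟩
      rwa [hop] at this

theorem mem_lang_iff {α : Regex k} (hα : α.Flat) (w : List (Fin k)) :
    w ∈ α.lang ↔ ∃ e, α.Matches (fun _ => []) w e := by
  have h0 : env ([] : List (RefSym k)) = fun _ => [] := rfl
  simp_rw [← h0, matches_iff hα]
  constructor
  · rintro ⟨r, hr, rfl⟩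
    exact ⟨_, r, hr, rfl, by simp [deref, resolve_eq_process, letters]⟩
  · rintro ⟨_, r, hr, rfl, hl⟩
    refine ⟨r, hr, ?_⟩
    simpa [deref, resolve_eq_process, letters] using hl

end Regex

end DetRegex
/-! ### Words and regex for the configurations of a machine -/

namespace DetRegex

variable {k m : ℕ} {X Y : Type}

namespace Regex

/-- The concatenation of a list of regex. -/
def seq : List (Regex k) → Regex k
  | [] => eps
  | α :: l => cat α (seq l)

/-- The regex matches exactly the words `f c`, whatever the values of the variables are, and does
not change them. -/
def Reads (α : Regex k) (f : X → List (Fin k)) : Prop :=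
  ∀ e w e', α.Matches e w e' ↔ (∃ c, w = f c) ∧ e' = e

/-- The word consists of `p` and a word that the sequence matches. -/
def After (p : List (Fin k)) (l : List (Regex k)) (e : Env k) (w : List (Fin k)) : Prop :=
  ∃ u e', w = p ++ u ∧ (seq l).Matches e u e'

/-- The lemmas on `After` serve as rewriting rules: `simp` runs through a sequence item by item,
collecting the word in `p` and the values in `e`. -/
theorem after_nil_iff (p : List (Fin k)) (e : Env k) (w : List (Fin k)) :
    After p [] e w ↔ w = p := by
  simp [After, seq, Matches]

theorem after_term (p : List (Fin k)) (a : Fin k) (l : List (Regex k)) (e : Env k)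
    (w : List (Fin k)) : After p (term a :: l) e w ↔ After (p ++ [a]) l e w := by
  constructor
  · rintro ⟨_, e', rfl, _, u, _, ⟨rfl, rfl⟩, h, rfl⟩
    exact ⟨u, e', by simp, h⟩
  · rintro ⟨u, e', rfl, h⟩
    exact ⟨_, e', by simp, _, u, _, ⟨rfl, rfl⟩, h, rfl⟩

theorem after_ref (p : List (Fin k)) (x : ℕ) (l : List (Regex k)) (e : Env k)
    (w : List (Fin k)) : After p (ref x :: l) e w ↔ After (p ++ e x) l e w := by
  constructor
  · rintro ⟨_, e', rfl, _, u, _, ⟨rfl, rfl⟩, h, rfl⟩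
    exact ⟨u, e', by simp, h⟩
  · rintro ⟨u, e', rfl, h⟩
    exact ⟨_, e', by simp, _, u, _, ⟨rfl, rfl⟩, h, rfl⟩

theorem after_terms (p u : List (Fin k)) (l : List (Regex k)) (e : Env k) (w : List (Fin k)) :
    After p (u.map term ++ l) e w ↔ After (p ++ u) l e w := by
  induction u generalizing p with
  | nil => simp
  | cons a u ih => simp [after_term, ih]

theorem Reads.after {α : Regex k} {f : X → List (Fin k)} (hα : α.Reads f) (p : List (Fin k))
    (l : List (Regex k)) (e : Env k) (w : List (Fin k)) :
    After p (α :: l) e w ↔ ∃ c, After (p ++ f c) l e w := by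
  constructor
  · rintro ⟨_, e', rfl, _, u, _, h, h', rfl⟩
    obtain ⟨⟨c, rfl⟩, rfl⟩ := (hα _ _ _).1 h
    exact ⟨c, u, e', by simp, h'⟩
  · rintro ⟨c, u, e', rfl, h⟩
    exact ⟨f c ++ u, e', by simp, _, u, _, (hα _ _ _).2 ⟨⟨c, rfl⟩, rfl⟩, h, rfl⟩

theorem Reads.after_bind {α : Regex k} {f : X → List (Fin k)} (hα : α.Reads f) (p : List (Fin k))
    (x : ℕ) (l : List (Regex k)) (e : Env k) (w : List (Fin k)) :
    After p (bind x α :: l) e w ↔ ∃ c, After (p ++ f c) l (Function.update e x (f c)) w := by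
  constructor
  · rintro ⟨_, e', rfl, _, u, _, ⟨⟨e₁, h⟩, rfl⟩, h', rfl⟩
    obtain ⟨⟨c, rfl⟩, -⟩ := (hα _ _ _).1 h
    exact ⟨c, u, e', by simp, h'⟩
  · rintro ⟨c, u, e', rfl, h⟩
    exact ⟨f c ++ u, e', by simp, _, u, _, ⟨⟨e, (hα _ _ _).2 ⟨⟨c, rfl⟩, rfl⟩⟩, rfl⟩, h, rfl⟩

theorem after_alt (p : List (Fin k)) (l l' : List (Regex k)) (e : Env k) (w : List (Fin k)) :
    After p [alt (seq l) (seq l')] e w ↔ After p l e w ∨ After p l' e w := by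
  constructor
  · rintro ⟨_, e', rfl, u, _, _, h | h, ⟨rfl, rfl⟩, rfl⟩
    exacts [.inl ⟨u, _, by simp, h⟩, .inr ⟨u, _, by simp, h⟩]
  · rintro (⟨u, e', rfl, h⟩ | ⟨u, e', rfl, h⟩)
    exacts [⟨u, e', rfl, u, [], _, .inl h, ⟨rfl, rfl⟩, by simp⟩,
      ⟨u, e', rfl, u, [], _, .inr h, ⟨rfl, rfl⟩, by simp⟩]

theorem after_seq (p : List (Fin k)) (l : List (Regex k)) (e : Env k) (w : List (Fin k)) :
    After p [seq l] e w ↔ After p l e w := by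
  constructor
  · rintro ⟨_, e', rfl, u, _, _, h, ⟨rfl, rfl⟩, rfl⟩
    exact ⟨u, _, by simp, h⟩
  · rintro ⟨u, e', rfl, h⟩
    exact ⟨u, e', rfl, u, [], _, h, ⟨rfl, rfl⟩, by simp⟩

theorem after_iff (p : List (Fin k)) (l : List (Regex k)) (e : Env k) (w : List (Fin k)) :
    After p l e w ↔ ∃ u, w = p ++ u ∧ After [] l e u := by
  simp [After]

theorem exists_matches_seq (l : List (Regex k)) (e : Env k) (w : List (Fin k)) :
    (∃ e', (seq l).Matches e w e') ↔ After [] l e w := by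
  simp [After]

theorem repeats_plus_iff {α : Regex k} {e e' : Env k} {w : List (Fin k)} :
    (alt (plus α) eps).Matches e w e' ↔ Repeats α.Matches e w e' := by
  constructor
  · rintro (⟨w₁, w₂, e₁, h₁, h₂, rfl⟩ | ⟨rfl, rfl⟩)
    exacts [.cons h₁ h₂, .nil _]
  · rintro (_ | ⟨h₁, h₂⟩)
    exacts [.inr ⟨rfl, rfl⟩, .inl ⟨_, _, _, h₁, h₂, rfl⟩]

theorem matches_loop {α β : Regex k} {e e' : Env k} {w : List (Fin k)} :
    (loop α β).Matches e w e' ↔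
      ∃ w₁ w₂ e₁, Repeats α.Matches e w₁ e₁ ∧ β.Matches e₁ w₂ e' ∧ w = w₁ ++ w₂ := by
  simp only [loop, Matches.eq_5, repeats_plus_iff]

theorem Reads.loop {α : Regex k} {f : X → List (Fin k)} (hα : α.Reads f) (a : Fin k) :
    (loop α (term a)).Reads fun l : List X => l.flatMap f ++ [a] := by
  intro e w e'
  rw [matches_loop]
  constructor
  · rintro ⟨w₁, _, e₁, h, ⟨rfl, rfl⟩, rfl⟩
    suffices hs : (∃ l : List X, w₁ = l.flatMap f) ∧ e' = e by
      obtain ⟨⟨l, rfl⟩, rfl⟩ := hs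
      exact ⟨⟨l, rfl⟩, rfl⟩
    induction h with
    | nil => exact ⟨⟨[], rfl⟩, rfl⟩
    | cons h _ ih =>
      obtain ⟨⟨l, rfl⟩, rfl⟩ := ih
      obtain ⟨⟨c, rfl⟩, rfl⟩ := (hα _ _ _).1 h
      exact ⟨⟨c :: l, rfl⟩, rfl⟩
  · rintro ⟨⟨l, rfl⟩, rfl⟩
    refine ⟨_, _, e', ?_, ⟨rfl, rfl⟩, rfl⟩
    induction l with
    | nil => exact .nil _
    | cons c l ih => exact .cons ((hα _ _ _).2 ⟨⟨c, rfl⟩, rfl⟩) ih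

theorem reads_term (a : Fin k) : (term a).Reads fun _ : Unit => [a] := by
  intro e w e'
  simp [Matches]

theorem Reads.cat {α β : Regex k} {f : X → List (Fin k)} {g : Y → List (Fin k)} (hα : α.Reads f)
    (hβ : β.Reads g) : (cat α β).Reads fun c : X × Y => f c.1 ++ g c.2 := by
  intro e w e'
  constructor
  · rintro ⟨_, _, _, h, h', rfl⟩
    obtain ⟨⟨c, rfl⟩, rfl⟩ := (hα _ _ _).1 h
    obtain ⟨⟨d, rfl⟩, rfl⟩ := (hβ _ _ _).1 h'
    exact ⟨⟨(c, d), rfl⟩, rfl⟩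
  · rintro ⟨⟨c, rfl⟩, rfl⟩
    exact ⟨_, _, _, (hα _ _ _).2 ⟨⟨_, rfl⟩, rfl⟩, (hβ _ _ _).2 ⟨⟨_, rfl⟩, rfl⟩, rfl⟩

theorem Reads.congr {α : Regex k} {f : X → List (Fin k)} {g : Y → List (Fin k)} (hα : α.Reads f)
    (F : X → Y) (G : Y → X) (hF : ∀ c, f c = g (F c)) (hG : ∀ d, g d = f (G d)) : α.Reads g := by
  intro e w e'
  rw [hα]
  refine and_congr_left fun _ => ⟨?_, ?_⟩
  · rintro ⟨c, rfl⟩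
    exact ⟨_, hF c⟩
  · rintro ⟨d, rfl⟩
    exact ⟨_, hG d⟩

end Regex

/-! #### Codes of numbers, lists and stacks -/

/-- The prefix-free code of a list of elements that are coded by `f`. -/
def encodeItems (f : X → List (Fin (m + 2))) (l : List X) : List (Fin (m + 2)) :=
  l.flatMap (fun c => 0 :: f c) ++ [1]

/-- The code of a number. -/
def encodeNat (n : ℕ) : List (Fin (m + 2)) := List.replicate n 0 ++ [1]

/-- The code of a list of numbers. -/
def encodeList : List ℕ → List (Fin (m + 2)) := encodeItems encodeNat

/-- The code of a stack of lists. -/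
def encodeStack : List (List ℕ) → List (Fin (m + 2)) := encodeItems encodeList

/-- The code of a configuration. -/
def encodeConfig (c : Instr.Config) : List (Fin (m + 2)) :=
  0 :: (encodeNat c.1 ++ (encodeList c.2.1 ++ encodeStack c.2.2))

theorem encodeNat_zero : (encodeNat 0 : List (Fin (m + 2))) = [1] := rfl

theorem encodeNat_succ (n : ℕ) :
    (encodeNat (n + 1) : List (Fin (m + 2))) = 0 :: encodeNat n := rfl

theorem encodeList_nil : (encodeList [] : List (Fin (m + 2))) = [1] := rfl

theorem encodeList_cons (n : ℕ) (l : List ℕ) :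
    (encodeList (n :: l) : List (Fin (m + 2))) = 0 :: (encodeNat n ++ encodeList l) := by
  simp [encodeList, encodeItems]

theorem encodeStack_nil : (encodeStack [] : List (Fin (m + 2))) = [1] := rfl

theorem encodeStack_cons (v : List ℕ) (s : List (List ℕ)) :
    (encodeStack (v :: s) : List (Fin (m + 2))) = 0 :: (encodeList v ++ encodeStack s) := by
  simp [encodeStack, encodeItems]

/-- No code word is a proper prefix of another one, and different objects have different codes. -/
def IsPrefixCode (f : X → List (Fin k)) : Prop :=
  ∀ c d u v, f c ++ u = f d ++ v → c = d ∧ u = v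

theorem isPrefixCode_encodeNat : IsPrefixCode (encodeNat (m := m)) := by
  intro n
  induction n with
  | zero =>
    rintro (_ | n') u v h
    · simpa [encodeNat_zero] using h
    · simp [encodeNat_zero, encodeNat_succ] at h
  | succ n ih =>
    rintro (_ | n') u v h
    · simp [encodeNat_zero, encodeNat_succ] at h
    · simp only [encodeNat_succ, List.cons_append, List.cons.injEq, true_and] at h
      obtain ⟨rfl, rfl⟩ := ih _ _ _ h
      exact ⟨rfl, rfl⟩

/-- The letter 0 or 1 tells whether another item follows, and an item determines its own end. -/
theorem IsPrefixCode.encodeItems {f : X → List (Fin (m + 2))} (hf : IsPrefixCode f) :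
    IsPrefixCode (encodeItems f) := by
  intro l
  induction l with
  | nil =>
    rintro (_ | ⟨d, l'⟩) u v h
    · simpa [DetRegex.encodeItems] using h
    · simp [DetRegex.encodeItems] at h
  | cons c l ih =>
    rintro (_ | ⟨d, l'⟩) u v h
    · simp [DetRegex.encodeItems] at h
    · simp only [DetRegex.encodeItems, List.flatMap_cons, List.cons_append, List.append_assoc,
        List.cons.injEq, true_and] at h
      obtain ⟨rfl, h⟩ := hf _ _ _ _ h
      obtain ⟨rfl, rfl⟩ := ih l' u v (by simpa [DetRegex.encodeItems] using h)
      exact ⟨rfl, rfl⟩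

theorem isPrefixCode_encodeConfig : IsPrefixCode (encodeConfig (m := m)) := by
  rintro ⟨q, l, s⟩ ⟨q', l', s'⟩ u v h
  simp only [encodeConfig, List.cons_append, List.append_assoc, List.cons.injEq, true_and] at h
  obtain ⟨rfl, h₁⟩ := isPrefixCode_encodeNat _ _ _ _ h
  obtain ⟨rfl, h₂⟩ := isPrefixCode_encodeNat.encodeItems _ _ _ _ h₁
  obtain ⟨rfl, h₃⟩ := isPrefixCode_encodeNat.encodeItems.encodeItems _ _ _ _ h₂
  exact ⟨rfl, h₃⟩

/-! ### Regex for the codes and their prefix-freeness. -/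

namespace Regex

/-- The codes of numbers. -/
def num : Regex (m + 2) := loop (term 0) (term 1)

/-- The codes of lists of elements whose codes are matched by `α`. -/
def items (α : Regex (m + 2)) : Regex (m + 2) := loop (cat (term 0) α) (term 1)

/-- The codes of configurations. -/
def config : Regex (m + 2) :=
  cat (term 0) (cat num (cat (items num) (items (items num))))

theorem reads_num : (num : Regex (m + 2)).Reads encodeNat := by
  refine ((reads_term 0).loop 1).congr List.length (fun n => List.replicate n ()) ?_ ?_
  · intro l
    induction l with
    | nil => rfl
    | cons c l ih => simpa [encodeNat_succ] using ih
  · intro n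
    induction n with
    | zero => rfl
    | succ n ih => simpa [encodeNat_succ, List.replicate_succ] using ih

theorem Reads.items {α : Regex (m + 2)} {f : X → List (Fin (m + 2))} (hα : α.Reads f) :
    (items α).Reads (encodeItems f) := by
  have h : (Regex.cat (term 0) α).Reads fun c => 0 :: f c :=
    ((reads_term 0).cat hα).congr Prod.snd (fun c => ((), c)) (fun _ => rfl) fun _ => rfl
  exact h.loop 1

theorem reads_list : (items num : Regex (m + 2)).Reads encodeList := reads_num.items

theorem reads_stack : (items (items num) : Regex (m + 2)).Reads encodeStack := reads_list.items

theorem reads_config : (config : Regex (m + 2)).Reads encodeConfig :=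
  ((reads_term 0).cat (reads_num.cat (reads_list.cat reads_stack))).congr Prod.snd
    (fun c => ((), c)) (fun _ => rfl) fun _ => rfl

theorem prefixFree_seq {l : List (Regex k)} (h : ∀ α ∈ l, α.PrefixFree) : (seq l).PrefixFree := by
  induction l with
  | nil => exact prefixFree_eps
  | cons α l ih => exact (h α (by simp)).cat (ih fun β hβ => h β (by simp [hβ]))

theorem zero_ne_one_letter : (0 : Fin (m + 2)) ≠ 1 := by simp

theorem prefixFree_num : (num : Regex (m + 2)).PrefixFree :=
  (prefixFree_term 0).loop (prefixFree_term 1) (beginsWith_term 0) (beginsWith_term 1)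
    zero_ne_one_letter

theorem PrefixFree.items {α : Regex (m + 2)} (h : α.PrefixFree) : (items α).PrefixFree :=
  ((prefixFree_term 0).cat h).loop (prefixFree_term 1) ((beginsWith_term 0).cat _)
    (beginsWith_term 1) zero_ne_one_letter

theorem prefixFree_config : (config : Regex (m + 2)).PrefixFree :=
  (prefixFree_term 0).cat (prefixFree_num.cat
    (prefixFree_num.items.cat prefixFree_num.items.items))

/-- A case distinction on the next terminal. -/
theorem prefixFree_alt_seq {l l' : List (Regex (m + 2))} (h : ∀ α ∈ l, α.PrefixFree)
    (h' : ∀ α ∈ l', α.PrefixFree) :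
    (alt (seq (term 1 :: l)) (seq (term 0 :: l'))).PrefixFree :=
  ((prefixFree_term 1).cat (prefixFree_seq h)).alt ((prefixFree_term 0).cat (prefixFree_seq h'))
    ((beginsWith_term 1).cat _) ((beginsWith_term 0).cat _) zero_ne_one_letter.symm

/-! #### The regex for the instructions -/

/-- The beginning of a configuration with address `q`. -/
def address (q : ℕ) : List (Regex (m + 2)) := (0 :: encodeNat q).map term

/-- The regex that matches a list and a stack and then the configuration that the instruction
yields, or the letter `1` for a halting instruction. -/
def branch : Instr → List (Regex (m + 2))
  | .zero q => [bind 0 (items num), bind 1 (items (items num))] ++ address q ++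
      [term 0, term 1, ref 0, ref 1]
  | .succ q => [alt
      -- On the empty list `headI` is 0, so the result is the list `[1]`, coded by 0011.
      (seq ([term 1, bind 1 (items (items num))] ++ address q ++
        [term 0, term 0, term 1, term 1, ref 1]))
      (seq ([term 0, bind 0 num, items num, bind 1 (items (items num))] ++ address q ++
        [term 0, term 0, ref 0, term 1, ref 1]))]
  | .tail q => [alt
      (seq ([term 1, bind 1 (items (items num))] ++ address q ++ [term 1, ref 1]))
      (seq ([term 0, num, bind 0 (items num), bind 1 (items (items num))] ++ address q ++
        [ref 0, ref 1]))]
  | .dup q => [bind 0 (items num), bind 1 (items (items num))] ++ address q ++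
      [ref 0, term 0, ref 0, ref 1]
  | .swap q => [bind 0 (items num), alt
      -- The head of an empty stack is by default the empty list.
      (seq ([term 1] ++ address q ++ [term 1, term 0, ref 0, term 1]))
      (seq ([term 0, bind 1 (items num), bind 2 (items (items num))] ++ address q ++
        [ref 1, term 0, ref 0, ref 2]))]
  | .cons q => [bind 0 (items num), alt
      -- An empty stack and an empty list on top of it both put the default number 0 in front.
      (seq ([term 1] ++ address q ++ [term 0, term 1, ref 0, term 1]))
      (seq [term 0, alt
        (seq ([term 1, bind 2 (items (items num))] ++ address q ++
          [term 0, term 1, ref 0, ref 2]))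
        (seq ([term 0, bind 1 num, items num, bind 2 (items (items num))] ++ address q ++
          [term 0, ref 1, ref 0, ref 2]))])]
  | .case q r => [alt
      -- The empty list is treated as having head 0 and empty tail.
      (seq ([term 1, bind 1 (items (items num))] ++ address q ++ [term 1, ref 1]))
      (seq [term 0, alt
        (seq ([term 1, bind 0 (items num), bind 1 (items (items num))] ++ address q ++
          [ref 0, ref 1]))
        (seq ([term 0, bind 0 num, bind 1 (items num), bind 2 (items (items num))] ++ address r ++
          [term 0, ref 0, ref 1, ref 2]))])]
  | .halt => [items num, items (items num), term 1]

theorem prefixFree_branch (i : Instr) : ∀ α ∈ (branch i : List (Regex (m + 2))), α.PrefixFree := by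
  have hn := prefixFree_num (m := m)
  have hl := hn.items
  have hs := hl.items
  cases i <;>
    simp [branch, address, or_imp, forall_and, prefixFree_alt_seq, prefixFree_term, prefixFree_ref,
      PrefixFree.bind, hn, hl, hs]
  all_goals
    refine prefixFree_alt_seq ?_ ?_ <;>
      simp [or_imp, forall_and, prefixFree_alt_seq, prefixFree_term, prefixFree_ref,
        PrefixFree.bind, hn, hl, hs]

/-- The word for the result of an instruction. -/
def encodeResult : Option Instr.Config → List (Fin (m + 2))
  | some c => encodeConfig c
  | none => [1]

theorem exists_list_iff {p : List X → Prop} : (∃ l, p l) ↔ p [] ∨ ∃ c l, p (c :: l) := by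
  constructor
  · rintro ⟨_ | ⟨c, l⟩, h⟩
    exacts [.inl h, .inr ⟨c, l, h⟩]
  · rintro (h | ⟨c, l, h⟩)
    exacts [⟨_, h⟩, ⟨_, h⟩]

theorem exists_nat_iff {p : ℕ → Prop} : (∃ n, p n) ↔ p 0 ∨ ∃ n, p (n + 1) := by
  constructor
  · rintro ⟨_ | n, h⟩
    exacts [.inl h, .inr ⟨n, h⟩]
  · rintro (h | ⟨n, h⟩)
    exacts [⟨_, h⟩, ⟨_, h⟩]

theorem after_address (p : List (Fin (m + 2))) (q : ℕ) (l : List (Regex (m + 2)))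
    (e : Env (m + 2)) (w : List (Fin (m + 2))) :
    After p (address q ++ l) e w ↔ After (p ++ 0 :: encodeNat q) l e w := after_terms _ _ _ _ _

/-- The list and the stack are split into exactly the cases that the disjunctions distinguish; both
sides then evaluate to the same words. Every reference follows a binding in its own branch, so
values left over in `e` do not matter. -/
theorem after_branch (i : Instr) (e : Env (m + 2)) (w : List (Fin (m + 2))) :
    After [] (branch i) e w ↔
      ∃ v s, w = encodeList v ++ (encodeStack s ++ encodeResult (i.exec v s)) := by
  have hd : (default : List ℕ) = [] := rfl
  cases i with
  | zero q =>
    simp [branch, Instr.exec, encodeResult, encodeConfig, after_address, after_term, after_ref,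
      after_nil_iff, reads_list.after_bind, reads_stack.after_bind, encodeList_cons, encodeNat_zero]
  | succ q =>
    rw [exists_list_iff]
    simp [branch, Instr.exec, encodeResult, encodeConfig, after_address, after_term, after_ref,
      after_nil_iff, after_alt, reads_list.after, reads_num.after_bind, reads_stack.after_bind,
      encodeList_cons, encodeNat_zero, encodeList_nil, encodeNat_succ]
  | tail q =>
    rw [exists_list_iff]
    simp [branch, Instr.exec, encodeResult, encodeConfig, after_address, after_term, after_ref,
      after_nil_iff, after_alt, reads_num.after, reads_list.after_bind, reads_stack.after_bind,
      encodeList_cons, encodeList_nil]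
  | dup q =>
    simp [branch, Instr.exec, encodeResult, encodeConfig, after_address, after_term, after_ref,
      after_nil_iff, reads_list.after_bind, reads_stack.after_bind, encodeStack_cons]
  | swap q =>
    have : ∀ p : List ℕ → List (List ℕ) → Prop, (∃ v s, p v s) ↔
        ∃ v, p v [] ∨ ∃ c s, p v (c :: s) := fun p => exists_congr fun v => exists_list_iff
    rw [this]
    simp [branch, Instr.exec, encodeResult, encodeConfig, after_address, after_term, after_ref,
      after_nil_iff, after_alt, reads_list.after_bind, reads_stack.after_bind,
      encodeStack_cons, encodeStack_nil, encodeList_nil, hd]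
  | cons q =>
    have : ∀ p : List ℕ → List (List ℕ) → Prop, (∃ v s, p v s) ↔
        ∃ v, p v [] ∨ (∃ s, p v ([] :: s)) ∨ ∃ n c s, p v ((n :: c) :: s) := fun p =>
      exists_congr fun v => exists_list_iff.trans (or_congr_right exists_list_iff)
    rw [this]
    simp [branch, Instr.exec, encodeResult, encodeConfig, after_address, after_term, after_ref,
      after_nil_iff, after_alt, reads_list.after_bind, reads_stack.after_bind, reads_num.after_bind,
      reads_list.after, encodeStack_cons, encodeStack_nil, encodeList_nil, encodeList_cons,
      encodeNat_zero, hd]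
  | case q r =>
    have : ∀ p : List ℕ → Prop, (∃ v, p v) ↔ p [] ∨ (∃ v, p (0 :: v)) ∨ ∃ n v, p ((n + 1) :: v) :=
      fun p => exists_list_iff.trans (or_congr_right exists_nat_iff)
    rw [this]
    simp [branch, Instr.exec, encodeResult, encodeConfig, after_address, after_term, after_ref,
      after_nil_iff, after_alt, reads_list.after_bind, reads_stack.after_bind, reads_num.after_bind,
      encodeList_nil, encodeList_cons, encodeNat_zero, encodeNat_succ]
  | halt =>
    simp [branch, Instr.exec, encodeResult, after_term, after_nil_iff, reads_list.after,
      reads_stack.after]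

end Regex

end DetRegex
/-! ### The reduction from the halting problem -/

namespace DetRegex

open StateTransition

variable {k m : ℕ}

namespace Regex

/-- The body of the number `n` in a list of bodies, preceded by the code of `n`. -/
def choice (b : List (Regex (m + 2))) : List (List (Regex (m + 2))) → Regex (m + 2)
  | [] => seq (term 1 :: b)
  | c :: cs => alt (seq (term 1 :: b)) (seq [term 0, choice c cs])

/-- Addresses are unary: each letter 0 skips one body and the letter 1 enters the current one. -/
theorem after_choice (bs : List (List (Regex (m + 2)))) (e : Env (m + 2)) :
    ∀ (b : List (Regex (m + 2))) (w : List (Fin (m + 2))), After [] [choice b bs] e w ↔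
      ∃ n c u, (b :: bs)[n]? = some c ∧ w = encodeNat n ++ u ∧ After [] c e u := by
  induction bs with
  | nil =>
    intro b w
    rw [choice, after_seq, after_term, after_iff]
    constructor
    · rintro ⟨u, rfl, h⟩
      exact ⟨0, b, u, rfl, rfl, h⟩
    · rintro ⟨_ | n, c, u, hc, rfl, h⟩
      · obtain rfl : b = c := by simpa using hc
        exact ⟨u, rfl, h⟩
      · simp at hc
  | cons d bs ih =>
    intro b w
    rw [choice, after_alt, after_term, after_iff, after_term, after_iff _ [choice d bs]]
    constructor
    · rintro (⟨u, rfl, h⟩ | ⟨u, rfl, h⟩)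
      · exact ⟨0, b, u, rfl, rfl, h⟩
      · obtain ⟨n, c, u', hc, rfl, h'⟩ := (ih _ _).1 h
        exact ⟨n + 1, c, u', hc, rfl, h'⟩
    · rintro ⟨_ | n, c, u, hc, rfl, h⟩
      · obtain rfl : b = c := by simpa using hc
        exact .inl ⟨u, rfl, h⟩
      · exact .inr ⟨_, rfl, (ih _ _).2 ⟨n, c, u, hc, rfl, h⟩⟩

theorem prefixFree_choice (bs : List (List (Regex (m + 2)))) :
    ∀ b : List (Regex (m + 2)), (∀ c ∈ b :: bs, ∀ α ∈ c, α.PrefixFree) →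
      (choice b bs).PrefixFree := by
  induction bs with
  | nil =>
    intro b h
    exact (prefixFree_term 1).cat (prefixFree_seq (h b (by simp)))
  | cons d bs ih =>
    intro b h
    refine prefixFree_alt_seq (h b (by simp)) ?_
    simpa using ih d fun c hc => h c (by simp at hc ⊢; tauto)

/-- A configuration of the program `i :: P`, followed by the result of its instruction. -/
def stepRegex (i : Instr) (P : List Instr) : Regex (m + 2) :=
  seq [term 0, choice (branch i) (P.map branch)]

/-- Pairs of equal configurations, and then two letters `1`. -/
def pairsRegex : Regex (m + 2) :=
  -- Variable 1 is never referenced; its binding makes the number of variables exactly two.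
  seq [bind 1 eps, loop (seq [bind 0 config, ref 0]) (seq [term 1, term 1])]

/-- The initial configuration of the program `i :: P` with input `n`, then configurations each
with its result, and then the letter `1`. -/
def traceRegex (i : Instr) (P : List Instr) (n : ℕ) : Regex (m + 2) :=
  -- The bindings of ε make all three variables occur, whatever the program uses. The letters 0, 1,
  -- 0, then the code of `n`, then 1, 1 spell the code of `(0, [n], [])`.
  seq ([bind 0 eps, bind 1 eps, bind 2 eps, term 0, term 1, term 0] ++ ((encodeNat n).map term ++
    [term 1, term 1, loop (stepRegex i P) (term 1)]))

/-! #### Syntactic properties -/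

theorem wellFormed_seq {l : List (Regex k)} :
    (seq l).WellFormed ↔ ∀ α ∈ l, α.WellFormed := by
  induction l with
  | nil => simp [seq, WellFormed]
  | cons α l ih => simp [seq, WellFormed, ih]

theorem flat_seq {l : List (Regex k)} : (seq l).Flat ↔ ∀ α ∈ l, α.Flat := by
  induction l with
  | nil => simp [seq, Flat]
  | cons α l ih => simp [seq, Flat, ih]

theorem mem_vars_seq {l : List (Regex k)} {x : ℕ} :
    x ∈ (seq l).vars ↔ ∃ α ∈ l, x ∈ α.vars := by
  induction l with
  | nil => simp [seq, vars]
  | cons α l ih => simp [seq, vars, ih]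

theorem vars_num : (num : Regex (m + 2)).vars = ∅ := rfl

theorem vars_list : (items num : Regex (m + 2)).vars = ∅ := rfl

theorem vars_stack : (items (items num) : Regex (m + 2)).vars = ∅ := rfl

theorem vars_config : (config : Regex (m + 2)).vars = ∅ := rfl

theorem wellFormed_num : (num : Regex (m + 2)).WellFormed := by simp [num, loop, WellFormed]

theorem WellFormed.items {α : Regex (m + 2)} (h : α.WellFormed) : (items α).WellFormed := by
  simp [Regex.items, loop, WellFormed, h]

theorem wellFormed_config : (config : Regex (m + 2)).WellFormed := by
  simp [config, WellFormed, wellFormed_num, wellFormed_num.items, wellFormed_num.items.items]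

theorem wellFormed_branch (i : Instr) :
    ∀ α ∈ (branch i : List (Regex (m + 2))), α.WellFormed := by
  have hn := wellFormed_num (m := m)
  have hl := hn.items
  have hs := hl.items
  cases i <;> simp [branch, address, or_imp, forall_and, WellFormed, wellFormed_seq, hn, hl, hs,
    vars_num, vars_list, vars_stack]

theorem flat_branch (i : Instr) : ∀ α ∈ (branch i : List (Regex (m + 2))), α.Flat := by
  have hn := flat_of_vars_eq_empty (vars_num (m := m))
  have hl := flat_of_vars_eq_empty (vars_list (m := m))
  have hs := flat_of_vars_eq_empty (vars_stack (m := m))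
  cases i <;> simp [branch, address, or_imp, forall_and, Flat, flat_seq, hn, hl, hs,
    vars_num, vars_list, vars_stack]

theorem vars_branch (i : Instr) :
    ∀ α ∈ (branch i : List (Regex (m + 2))), ∀ x ∈ α.vars, x < 3 := by
  cases i <;> simp [branch, address, or_imp, forall_and, vars, mem_vars_seq,
    vars_num, vars_list, vars_stack]

theorem wellFormed_choice (bs : List (List (Regex (m + 2)))) :
    ∀ b : List (Regex (m + 2)), (∀ c ∈ b :: bs, ∀ α ∈ c, α.WellFormed) →
      (choice b bs).WellFormed := by
  induction bs with
  | nil =>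
    intro b h
    exact ⟨trivial, wellFormed_seq.2 (h b (by simp))⟩
  | cons d bs ih =>
    intro b h
    exact ⟨⟨trivial, wellFormed_seq.2 (h b (by simp))⟩, trivial,
      ih d fun c hc => h c (by simp at hc ⊢; tauto), trivial⟩

theorem flat_choice (bs : List (List (Regex (m + 2)))) :
    ∀ b : List (Regex (m + 2)), (∀ c ∈ b :: bs, ∀ α ∈ c, α.Flat) → (choice b bs).Flat := by
  induction bs with
  | nil =>
    intro b h
    exact ⟨trivial, flat_seq.2 (h b (by simp))⟩
  | cons d bs ih =>
    intro b h
    exact ⟨⟨trivial, flat_seq.2 (h b (by simp))⟩, trivial,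
      ih d fun c hc => h c (by simp at hc ⊢; tauto), trivial⟩

theorem vars_choice {x : ℕ} (bs : List (List (Regex (m + 2)))) : ∀ b : List (Regex (m + 2)),
    x ∈ (choice b bs).vars → ∃ c ∈ b :: bs, ∃ α ∈ c, x ∈ α.vars := by
  induction bs with
  | nil =>
    intro b h
    simpa [choice, mem_vars_seq, vars] using h
  | cons d bs ih =>
    intro b h
    have h : (∃ α ∈ b, x ∈ α.vars) ∨ x ∈ (choice d bs).vars := by
      simpa [choice, mem_vars_seq, vars] using h
    rcases h with h | h
    · exact ⟨b, by simp, h⟩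
    · obtain ⟨c, hc, h⟩ := ih d h
      exact ⟨c, List.mem_cons_of_mem _ hc, h⟩

theorem forall_branches {p : Regex (m + 2) → Prop} (h : ∀ i, ∀ α ∈ branch i, p α) (i : Instr)
    (P : List Instr) : ∀ c ∈ branch i :: P.map branch, ∀ α ∈ c, p α := by
  rw [← List.map_cons]
  intro c hc
  obtain ⟨j, -, rfl⟩ := List.mem_map.1 hc
  exact h j

theorem flat_stepRegex (i : Instr) (P : List Instr) : (stepRegex i P : Regex (m + 2)).Flat :=
  ⟨trivial, flat_choice _ _ (forall_branches flat_branch i P), trivial⟩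

theorem flat_pairsRegex : (pairsRegex : Regex (m + 2)).Flat := by
  simp [pairsRegex, flat_seq, Flat, loop, vars, vars_config]

theorem flat_traceRegex (i : Instr) (P : List Instr) (n : ℕ) :
    (traceRegex i P n : Regex (m + 2)).Flat := by
  simp [traceRegex, flat_seq, Flat, loop, vars, or_imp, forall_and, flat_stepRegex]

theorem vars_pairsRegex : (pairsRegex : Regex (m + 2)).vars.card = 2 := by
  simp [pairsRegex, seq, loop, vars, vars_config]

theorem vars_traceRegex (i : Instr) (P : List Instr) (n : ℕ) :
    (traceRegex i P n : Regex (m + 2)).vars.card = 3 := by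
  have h : ∀ x ∈ (stepRegex i P : Regex (m + 2)).vars, x < 3 := by
    intro x hx
    have hx : x ∈ (choice (branch i) (P.map branch) : Regex (m + 2)).vars := by
      simpa [stepRegex, mem_vars_seq, vars] using hx
    obtain ⟨c, hc, α, hα, hx⟩ := vars_choice _ _ hx
    exact forall_branches (p := fun α => ∀ x ∈ α.vars, x < 3) vars_branch i P c hc α hα x hx
  have h' : (traceRegex i P n : Regex (m + 2)).vars = Finset.range 3 := by
    ext x
    have hs : x ∈ (stepRegex i P : Regex (m + 2)).vars → x < 3 := h x
    simp [traceRegex, mem_vars_seq, loop, vars, or_and_right, exists_or]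
    by_cases hx : x ∈ (stepRegex i P : Regex (m + 2)).vars
    · simpa [hx] using hs hx
    · simp only [hx, or_false]
      omega
  rw [h', Finset.card_range]

theorem isDeterministicRegex_pairsRegex :
    (pairsRegex : Regex (m + 2)).IsDeterministicRegex := by
  refine ⟨.inr ?_, PrefixFree.not_isNondeterministic ?_⟩
  · simp [pairsRegex, wellFormed_seq, WellFormed, loop, vars, vars_config, wellFormed_config]
  · refine (prefixFree_eps.bind 1).cat (.cat (.loop (a := 0) (b := 1) ?_ ?_ ?_ ?_
      zero_ne_one_letter) prefixFree_eps)
    · exact (prefixFree_config.bind 0).cat ((prefixFree_ref 0).cat prefixFree_eps)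
    · exact (prefixFree_term 1).cat ((prefixFree_term 1).cat prefixFree_eps)
    · exact (((beginsWith_term 0).cat _).bind 0).cat _
    · exact (beginsWith_term 1).cat _

theorem isDeterministicRegex_traceRegex (i : Instr) (P : List Instr) (n : ℕ) :
    (traceRegex i P n : Regex (m + 2)).IsDeterministicRegex := by
  refine ⟨.inr ?_, PrefixFree.not_isNondeterministic (prefixFree_seq ?_)⟩
  · have := wellFormed_choice _ _ (forall_branches (m := m) wellFormed_branch i P)
    simp [traceRegex, stepRegex, wellFormed_seq, WellFormed, loop, vars, or_imp, forall_and, this]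
  · have h : (stepRegex i P : Regex (m + 2)).PrefixFree :=
      (prefixFree_term 0).cat ((prefixFree_choice _ _ (forall_branches prefixFree_branch i P)).cat
        prefixFree_eps)
    have h' := h.loop (prefixFree_term 1) ((beginsWith_term 0).cat _) (beginsWith_term 1)
      zero_ne_one_letter
    simp [or_imp, forall_and, prefixFree_eps, PrefixFree.bind, prefixFree_term, h']

/-! #### The languages -/

theorem after_singleton (α : Regex k) (e : Env k) (w : List (Fin k)) :
    After [] [α] e w ↔ ∃ e', α.Matches e w e' := by
  constructor
  · rintro ⟨_, e', rfl, u, _, _, h, ⟨rfl, rfl⟩, rfl⟩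
    exact ⟨_, by simpa using h⟩
  · rintro ⟨e', h⟩
    exact ⟨w, e', rfl, w, [], e', h, ⟨rfl, rfl⟩, by simp⟩

theorem reads_eps : (eps : Regex k).Reads fun _ : Unit => [] := by
  intro e w e'
  simp [Matches]

/-- The words of `pairsRegex`. -/
def doubled (cs : List Instr.Config) : List (Fin (m + 2)) :=
  cs.flatMap (fun c => encodeConfig c ++ encodeConfig c) ++ [1, 1]

theorem matches_pair (e : Env (m + 2)) (w : List (Fin (m + 2))) :
    (∃ e', (seq [bind 0 config, ref 0]).Matches e w e') ↔
      ∃ c, w = encodeConfig c ++ encodeConfig c := by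
  rw [exists_matches_seq]
  simp [reads_config.after_bind, after_ref, after_nil_iff]

theorem mem_lang_pairsRegex (w : List (Fin (m + 2))) :
    w ∈ (pairsRegex : Regex (m + 2)).lang ↔ ∃ cs, w = doubled cs := by
  rw [mem_lang_iff flat_pairsRegex, pairsRegex, exists_matches_seq, reads_eps.after_bind]
  simp only [List.append_nil, exists_const, after_singleton, matches_loop]
  -- Each round binds its variable anew, so the initial values are irrelevant.
  generalize Function.update (fun _ : ℕ => ([] : List (Fin (m + 2)))) 1 [] = e
  constructor
  · rintro ⟨e', w₁, w₂, e₁, h, h', rfl⟩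
    have hw : w₂ = [1, 1] := by
      have := (exists_matches_seq _ _ _).1 ⟨e', h'⟩
      simpa [after_term, after_nil_iff] using this
    suffices hs : ∃ cs : List Instr.Config,
        w₁ = cs.flatMap fun c => encodeConfig c ++ encodeConfig c by
      obtain ⟨cs, rfl⟩ := hs
      exact ⟨cs, by rw [hw, doubled]⟩
    clear h' hw
    induction h with
    | nil => exact ⟨[], rfl⟩
    | cons h _ ih =>
      obtain ⟨c, rfl⟩ := (matches_pair _ _).1 ⟨_, h⟩
      obtain ⟨cs, rfl⟩ := ih
      exact ⟨c :: cs, rfl⟩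
  · rintro ⟨cs, rfl⟩
    have h : ∀ e : Env (m + 2), ∃ e₁, Repeats (seq [bind 0 config, ref 0]).Matches e
        (cs.flatMap fun c => encodeConfig c ++ encodeConfig c) e₁ := by
      induction cs with
      | nil => exact fun e => ⟨e, .nil e⟩
      | cons c cs ih =>
        intro e
        obtain ⟨e₁, h₁⟩ := (matches_pair e _).2 ⟨c, rfl⟩
        obtain ⟨e₂, h₂⟩ := ih e₁
        exact ⟨e₂, .cons h₁ h₂⟩
    obtain ⟨e₁, h⟩ := h e
    have h' : After [] [term 1, term 1] e₁ ([1, 1] : List (Fin (m + 2))) := by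
      simp [after_term, after_nil_iff]
    obtain ⟨e', h'⟩ := (exists_matches_seq _ _ _).2 h'
    exact ⟨e', _, _, e₁, h, h', rfl⟩

/-- Sequences of configurations, each followed by the result of its instruction. -/
inductive Trace (P : List Instr) : List (Fin (m + 2)) → Prop
  | nil : Trace P [1]
  | cons {q i u} (v s) : P[q]? = some i → Trace P u →
      Trace P (encodeConfig (q, v, s) ++ (encodeResult (i.exec v s) ++ u))

theorem matches_stepRegex (i : Instr) (P : List Instr) (e : Env (m + 2))
    (w : List (Fin (m + 2))) : (∃ e', (stepRegex i P).Matches e w e') ↔ ∃ q j v s,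
      (i :: P)[q]? = some j ∧ w = encodeConfig (q, v, s) ++ encodeResult (j.exec v s) := by
  rw [stepRegex, exists_matches_seq, after_term, after_iff]
  simp only [after_choice, ← List.map_cons, List.getElem?_map, Option.map_eq_some_iff]
  constructor
  · rintro ⟨_, rfl, q, _, u, ⟨j, hj, rfl⟩, rfl, h⟩
    obtain ⟨v, s, rfl⟩ := (after_branch _ _ _).1 h
    exact ⟨q, j, v, s, hj, by simp [encodeConfig]⟩
  · rintro ⟨q, j, v, s, hj, rfl⟩
    exact ⟨_, by simp [encodeConfig], q, _, _, ⟨j, hj, rfl⟩, rfl,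
      (after_branch _ _ _).2 ⟨v, s, rfl⟩⟩

theorem matches_loop_stepRegex (i : Instr) (P : List Instr) (e : Env (m + 2))
    (w : List (Fin (m + 2))) :
    (∃ e', (loop (stepRegex i P) (term 1)).Matches e w e') ↔ Trace (i :: P) w := by
  simp only [matches_loop]
  constructor
  · rintro ⟨e', w₁, _, e₁, h, ⟨rfl, rfl⟩, rfl⟩
    induction h with
    | nil => exact .nil
    | cons h _ ih =>
      obtain ⟨q, j, v, s, hj, rfl⟩ := (matches_stepRegex i P _ _).1 ⟨_, h⟩
      simpa using Trace.cons v s hj ih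
  · intro h
    induction h generalizing e with
    | nil => exact ⟨e, [], [1], e, .nil e, ⟨rfl, rfl⟩, rfl⟩
    | @cons q j u v s hj _ ih =>
      obtain ⟨e₁, h₁⟩ := (matches_stepRegex i P e _).2 ⟨q, j, v, s, hj, rfl⟩
      obtain ⟨e', w₁, w₂, e₂, h₂, h₃, rfl⟩ := ih e₁
      exact ⟨e', _, _, e₂, .cons h₁ h₂, h₃, by simp⟩

theorem mem_lang_traceRegex (i : Instr) (P : List Instr) (n : ℕ) (w : List (Fin (m + 2))) :
    w ∈ (traceRegex i P n : Regex (m + 2)).lang ↔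
      ∃ u, w = encodeConfig (0, [n], []) ++ u ∧ Trace (i :: P) u := by
  rw [mem_lang_iff (flat_traceRegex i P n), traceRegex, exists_matches_seq]
  simp only [List.cons_append, List.nil_append, reads_eps.after_bind, after_term, after_terms,
    List.append_nil, exists_const]
  rw [after_iff]
  simp only [after_singleton, matches_loop_stepRegex]
  simp [encodeConfig, encodeNat_zero, encodeList_cons, encodeList_nil, encodeStack_nil]

/-- The configuration `c` is the pending first half of a pair. Unique decoding makes it equal to the
next configuration of the trace, whose result is then the first half of the following pair. A trace
that stops without a halting instruction would leave a pair incomplete. -/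
theorem dom_of_trace {P : List Instr} {u : List (Fin (m + 2))} (h : Trace P u) :
    ∀ (c : Instr.Config) (cs : List Instr.Config), encodeConfig c ++ u = doubled cs →
      (eval (Instr.step P) c).Dom := by
  induction h with
  | nil =>
    rintro c (_ | ⟨d, cs⟩) h
    · simp [doubled, encodeConfig] at h
    · simp only [doubled, List.flatMap_cons, List.append_assoc] at h
      obtain ⟨-, h⟩ := isPrefixCode_encodeConfig _ _ _ _ h
      simp [encodeConfig] at h
  | @cons q i u v s hi _ ih =>
    rintro c (_ | ⟨d, cs⟩) h
    · simp [doubled, encodeConfig] at h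
    · simp only [doubled, List.flatMap_cons, List.append_assoc] at h
      obtain ⟨rfl, h₁⟩ := isPrefixCode_encodeConfig _ _ _ _ h
      obtain ⟨rfl, h₂⟩ := isPrefixCode_encodeConfig _ _ _ _ h₁
      have hs := Instr.step_of_get hi v s
      cases hr : i.exec v s with
      | none =>
        exact Part.dom_iff_mem.2 ⟨_, mem_eval.2 ⟨.refl, hs.trans hr⟩⟩
      | some c =>
        rw [hr] at h₂ hs
        rw [reaches_eval (.single hs)]
        exact ih c cs h₂

theorem exists_trace_of_dom {P : List Instr} {c : Instr.Config}
    (h : (eval (Instr.step P) c).Dom) :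
    ∃ (u : List (Fin (m + 2))) (cs : List Instr.Config),
      Trace P u ∧ encodeConfig c ++ u = doubled cs := by
  obtain ⟨b, hb⟩ := Part.dom_iff_mem.1 h
  obtain ⟨hr, hb'⟩ := mem_eval.1 hb
  clear h hb
  induction hr using Relation.ReflTransGen.head_induction_on with
  | refl =>
    obtain ⟨q, v, s⟩ := b
    cases hi : P[q]? with
    -- A machine without an instruction idles forever, so a final configuration has an instruction.
    | none => simp [Instr.step, hi] at hb'
    | some i =>
      rw [Instr.step_of_get hi] at hb'
      -- The halting result and the end of the trace supply the two final letters 1.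
      exact ⟨_, [(q, v, s)], .cons v s hi .nil, by simp [hb', doubled, encodeResult]⟩
  | @head c c' hc _ ih =>
    obtain ⟨u, cs, hu, h⟩ := ih
    obtain ⟨q, v, s⟩ := c
    cases hi : P[q]? with
    | none =>
      obtain rfl : (q, v, s) = c' := by simpa [Instr.step, hi] using hc
      exact ⟨u, cs, hu, h⟩
    | some i =>
      have hc : i.exec v s = some c' := (Instr.step_of_get hi v s).symm.trans hc
      refine ⟨_, (q, v, s) :: cs, .cons v s hi hu, ?_⟩
      have h' : encodeConfig c' ++ u =
        cs.flatMap (fun c => encodeConfig c ++ encodeConfig c) ++ [1, 1] := h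
      simp [hc, doubled, encodeResult, h']

theorem lang_inter_eq_empty_iff (i : Instr) (P : List Instr) (n : ℕ) :
    (pairsRegex : Regex (m + 2)).lang ∩ (traceRegex i P n).lang = ∅ ↔
      ¬ (eval (Instr.step (i :: P)) (0, [n], [])).Dom := by
  rw [← Set.not_nonempty_iff_eq_empty, not_iff_not]
  constructor
  · rintro ⟨w, h, h'⟩
    obtain ⟨cs, rfl⟩ := (mem_lang_pairsRegex _).1 h
    obtain ⟨u, hu, ht⟩ := (mem_lang_traceRegex _ _ _ _).1 h'
    exact dom_of_trace ht _ _ hu.symm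
  · intro h
    obtain ⟨u, cs, hu, h⟩ := exists_trace_of_dom (m := m) h
    exact ⟨_, (mem_lang_pairsRegex _).2 ⟨cs, h⟩, (mem_lang_traceRegex _ _ _ _).2 ⟨u, rfl, hu⟩⟩

/-! #### Computability of the reduction -/

/-- The Gödel number of a concatenation is arithmetic in that of its second factor, by definition.
-/
theorem primrec_cat (α : Regex k) : Primrec (cat α) := by
  rw [← Primrec.encode_iff]
  have h : Primrec fun β : Regex k =>
      5 * Nat.pair α.code (Encodable.encode β) + 1 + (k + 2) :=
    Primrec.nat_add.comp (Primrec.nat_add.comp (Primrec.nat_mul.comp (Primrec.const 5)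
      (Primrec₂.natPair.comp (Primrec.const _) Primrec.encode)) (Primrec.const 1))
      (Primrec.const (k + 2))
  exact h

theorem primrec_seq_append {F : ℕ → List (Regex k)} (hF : Primrec fun n => seq (F n))
    (l : List (Regex k)) : Primrec fun n => seq (l ++ F n) := by
  induction l with
  | nil => exact hF
  | cons α l ih => exact (primrec_cat α).comp ih

theorem primrec_traceRegex (i : Instr) (P : List Instr) :
    Primrec (traceRegex i P : ℕ → Regex (m + 2)) := by
  refine primrec_seq_append ?_ _
  generalize [term 1, term 1, loop (stepRegex i P) (term 1)] = l
  -- Only the unary block depends on the input; passing from `n` to `n + 1` puts one more `cat (term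
  -- 0)` in front.
  refine (Primrec.nat_rec₁ (seq ((encodeNat 0).map term ++ l))
    ((primrec_cat (term 0)).comp Primrec.snd).to₂).of_eq fun n => ?_
  induction n with
  | zero => rfl
  | succ n ih => exact congrArg (cat (term 0)) ih

end Regex

/-! ### Promise problems and the conclusion. -/

theorem DecidableGiven.mono {X : Type} [Primcodable X] {P P' Q : X → Prop}
    (h : DecidableGiven P Q) (hP : ∀ x, P' x → P x) : DecidableGiven P' Q :=
  let ⟨f, hf, h⟩ := h
  ⟨f, hf, fun x hx => h x (hP x hx)⟩

/-- A problem that is decidable under a promise is decidable on the range of a computable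
function that keeps the promise. -/
theorem DecidableGiven.computablePred {X Y : Type} [Primcodable X] [Primcodable Y]
    {P Q : X → Prop} (h : DecidableGiven P Q) {g : Y → X} (hg : Computable g)
    (hP : ∀ y, P (g y)) : ComputablePred fun y => Q (g y) := by
  classical
  obtain ⟨f, hf, h⟩ := h
  refine ⟨inferInstance, (hf.comp hg).of_eq fun y => ?_⟩
  obtain ⟨b, hb, h⟩ := h (g y) (hP y)
  refine Part.eq_some_iff.2 ?_
  convert hb
  rw [Bool.eq_iff_iff, h, decide_eq_true_iff]

theorem not_decidableGiven_vars (m : ℕ) :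
    ¬ DecidableGiven (fun p : Regex (m + 2) × Regex (m + 2) =>
        p.1.IsDeterministicRegex ∧ p.2.IsDeterministicRegex ∧
          p.1.vars.card = 2 ∧ p.2.vars.card = 3)
      (fun p => p.1.lang ∩ p.2.lang = ∅) := by
  intro h
  obtain ⟨i, P, hP⟩ := Instr.exists_undecidable_program
  have h := h.computablePred
    (g := fun n : ℕ => ((Regex.pairsRegex, Regex.traceRegex i P n) :
      Regex (m + 2) × Regex (m + 2)))
    ((Computable.const _).pair (Regex.primrec_traceRegex i P).to_comp)
    fun n => ⟨Regex.isDeterministicRegex_pairsRegex, Regex.isDeterministicRegex_traceRegex i P n,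
      Regex.vars_pairsRegex, Regex.vars_traceRegex i P n⟩
  simp only [Regex.lang_inter_eq_empty_iff] at h
  -- Emptiness expresses that the program does not halt, so the complement is taken.
  exact hP (by simpa using h.not)

end DetRegex

theorem mainTheorem3 (k : ℕ) (hk : 2 ≤ k) :
    (¬ DetRegex.DecidableGiven
        (fun p : DetRegex.Regex k × DetRegex.Regex k =>
          p.1.IsDeterministicRegex ∧ p.2.IsDeterministicRegex)
        (fun p => p.1.lang ∩ p.2.lang = ∅)) ∧
    (¬ DetRegex.DecidableGiven
        (fun p : DetRegex.Regex k × DetRegex.Regex k =>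
          p.1.IsDeterministicRegex ∧ p.2.IsDeterministicRegex ∧
            p.1.vars.card = 2 ∧ p.2.vars.card = 3)
        (fun p => p.1.lang ∩ p.2.lang = ∅)) := by
  obtain ⟨m, rfl⟩ := Nat.exists_eq_add_of_le' hk
  have h := DetRegex.not_decidableGiven_vars m
  exact ⟨fun h' => h (h'.mono fun _ hp => ⟨hp.1, hp.2.1⟩), h⟩
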